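/- \textbf{Theorem (Boolean Beth definability for $\mathrm{L}_{\infty\omega}$).} \emph{Syntax.} Let $\mathrm{L}$ be a relational first-order signature (a set of relation symbols of finite arity and of constant symbols), let $n\in\mathbb{N}$, let $R$ be an $n$-ary relation symbol not in $\mathrm{L}$, and put $\mathrm{L}'=\mathrm{L}\cup\{R\}$. The variables are $v_\alpha$, $\alpha$ an ordinal. The $\mathrm{L}_{\infty\omega}$-formulae are built from atomic formulae ($=$ and the relation symbols) by $\neg$, by conjunctions $\bigwedge\Phi$ of arbitrary (possibly empty) sets $\Phi$ of formulae whose free variables all lie in one finite set, and by quantification $\forall \bar v\,\varphi$ over finite strings of distinct variables; $\bigvee$, $\exists$, $\to$, $\leftrightarrow$ are the usual abbreviations, and formulae are taken up to renaming of bound variables. Let $T$ be a set of $\mathrm{L}'_{\infty\omega}$-sentences. \emph{Proofs.} $\Gamma\vdash\Delta$, for sets $\Gamma,\Delta$ of formulae, means that this sequent has a (possibly transfinite) derivation by the following rules, where substitution avoids capture: \begin{itemize} \item axiom: $\Gamma,\varphi\vdash\varphi,\Delta$; \item cut: from $\Gamma,\varphi\vdash\Delta$ and $\Gamma'\vdash\varphi,\Delta'$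 infer $\Gamma,\Gamma'\vdash\Delta,\Delta'$; \item substitution of variables for variables in a whole sequent; weakening: from $\Gamma\vdash\Delta$ infer $\Gamma,\Gamma'\vdash\Delta,\Delta'$; \item negation: from $\Gamma\vdash\varphi,\Delta$ infer $\Gamma,\neg\varphi\vdash\Delta$; from $\Gamma,\varphi\vdash\Delta$ infer $\Gamma\vdash\neg\varphi,\Delta$; \item conjunction: from $\Gamma,\Phi\vdash\Delta$ infer $\Gamma,\bigwedge\Phi\vdash\Delta$; from $\Gamma\vdash\varphi,\Delta$ for all $\varphi\in\Phi$ infer $\Gamma\vdash\bigwedge\Phi,\Delta$; \item quantification: from $\Gamma,\varphi(\bar t/\bar v)\vdash\Delta$ infer $\Gamma,\forall\bar v\,\varphi\vdash\Delta$ for any terms $\bar t$; from $\Gamma\vdash\varphi(\bar w/\bar v),\Delta$ infer $\Gamma\vdash\forall\bar v\,\varphi,\Delta$ if $\bar w$ are distinct variables that are not free in $\Gamma$, $\Delta$ or $\forall\bar v\,\varphi$; \item equality: $\vdash t=t$; $\;x=y\vdash y=x$ for variables $x,y$; $\;\bar u=\bar t,\ \varphi(\bar t)\vdash\varphi(\bar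 u)$. \end{itemize} \emph{Models.} For a complete Boolean algebra $\mathsf{B}$, a $\mathsf{B}$-valued model $\mathcal{M}$ for a signature consists of a non-empty set $M$, functions $[\![\cdot=\cdot]\!]:M^2\to\mathsf{B}$ and $[\![S(\cdot)]\!]:M^k\to\mathsf{B}$ for every $k$-ary relation symbol $S$, and elements $c^{\mathcal{M}}\in M$ for the constants $c$, such that for all elements of $M$ $$[\![\tau=\tau]\!]=1,\quad [\![\tau=\sigma]\!]=[\![\sigma=\tau]\!],\quad [\![\tau=\sigma]\!]\wedge[\![\sigma=\pi]\!]\le[\![\tau=\pi]\!],\quad \Big(\bigwedge_{i}[\![\tau_i=\sigma_i]\!]\Big)\wedge[\![S(\bar\tau)]\!]\le[\![S(\bar\sigma)]\!].$$ Values of formulae are computed in $\mathsf{B}$, with $\neg$, $\bigwedge$ interpreted by complement and infimum and $\forall\bar v$ by the infimum over all tuples of $M$. $\mathcal{M}$ is a model of $T$ if every member of $T$ has value $1$. \emph{Claim.} The following are equivalent. \begin{enumerate} \item ($R$ is implicitly Boolean definable from $T$.) For every complete Boolean algebra $\mathsf{B}$ and all $\mathsf{B}$-valued models $\mathcal{M},\mathcal{N}$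 of $T$ with the same domain $M$ and $\mathcal{M}\restriction\mathrm{L}=\mathcal{N}\restriction\mathrm{L}$, one has $[\![R(\bar\tau)]\!]^{\mathcal{M}}=[\![R(\bar\tau)]\!]^{\mathcal{N}}$ for all $\bar\tau\in M^n$. \item ($R$ is explicitly Boolean definable from $T$ in $\mathrm{L}_{\infty\omega}$.) There is an $\mathrm{L}_{\infty\omega}$-formula $\varphi(v_0,\dots,v_{n-1})$, with no further free variables, such that $$T\vdash\forall v_0\dots v_{n-1}\,\big(R(v_0,\dots,v_{n-1})\leftrightarrow\varphi(v_0,\dots,v_{n-1})\big).$$ \end{enumerate} -/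

import Mathlib

universe u

namespace InfLogic

/-- A relational `ω`-signature: relation symbols of finite arity and constant symbols. -/
structure Signature where
  /-- the relation symbols -/
  Rel : Type u
  /-- the arity of a relation symbol -/
  arity : Rel → ℕ
  /-- the constant symbols -/
  Const : Type u

/-- The signature `L ∪ {R}` for a new relation symbol `R` of arity `k`; the new symbol is `none`. -/
def Signature.adjoin (L : Signature.{u}) (k : ℕ) : Signature.{u} where
  Rel := Option L.Rel
  arity := fun R => R.elim k L.arity
  Const := L.Const

/-- The variables `v_α`, one for each ordinal `α`. -/
abbrev Var : Type (u + 1) := Ordinal.{u}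

/-- Terms. Bound variables are de Bruijn indices `bvar i` with `i < n`, so that formulae are taken
up to renaming of bound variables; `fvar x` is the variable `x` occurring free. -/
inductive Term (L : Signature.{u}) (n : ℕ) : Type (u + 1)
  | bvar (i : Fin n) : Term L n
  | fvar (x : Var.{u}) : Term L n
  | const (c : L.Const) : Term L n

/-- Pre-formulae: built from atomic ones with `¬`, set-sized conjunctions `⋀` and quantification
`∀ v₀ … v_{k-1}` over finite strings of variables. A pre-formula in `PreFormula L n` has `n` open
slots `bvar 0, …, bvar (n - 1)`, waiting for a quantifier or for terms. In `all k φ` the slots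
`0, …, k - 1` of `φ` are quantified and the slot `k + i` of `φ` is the slot `i` of `all k φ`. -/
inductive PreFormula (L : Signature.{u}) : ℕ → Type (u + 1)
  | eq {n : ℕ} (t s : Term L n) : PreFormula L n
  | rel {n : ℕ} (R : L.Rel) (t : Fin (L.arity R) → Term L n) : PreFormula L n
  | neg {n : ℕ} (φ : PreFormula L n) : PreFormula L n
  | conj {n : ℕ} {ι : Type u} (f : ι → PreFormula L n) : PreFormula L n
  | all {n : ℕ} (k : ℕ) (φ : PreFormula L (k + n)) : PreFormula L n

variable {L : Signature.{u}} {n m : ℕ}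

/-! ### Free variables, formulae and sentences -/

def Term.freeVars : Term L n → Set Var.{u}
  | .bvar _ => ∅
  | .fvar x => {x}
  | .const _ => ∅

def PreFormula.freeVars : {n : ℕ} → PreFormula L n → Set Var.{u}
  | _, .eq t s => t.freeVars ∪ s.freeVars
  | _, .rel _ t => ⋃ i, (t i).freeVars
  | _, .neg φ => φ.freeVars
  | _, .conj f => ⋃ i, (f i).freeVars
  | _, .all _ φ => φ.freeVars

/-- The `L_{∞ω}`-formulae are the pre-formulae with finitely many free variables. All
subformulae then have finitely many free variables as well. -/
def PreFormula.IsFormula (φ : PreFormula L n) : Prop := φ.freeVars.Finite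

/-- A pre-formula whose only free variables are its open slots; for `n = 0`, a sentence. -/
def PreFormula.IsSentence (φ : PreFormula L n) : Prop := φ.freeVars = ∅

/-! ### Derived connectives -/

def PreFormula.and (φ ψ : PreFormula L n) : PreFormula L n :=
  .conj (fun b : ULift.{u} Bool => if b.down then φ else ψ)

/-- `φ → ψ` is `¬ (φ ∧ ¬ ψ)`. -/
def PreFormula.imp (φ ψ : PreFormula L n) : PreFormula L n := .neg (φ.and (.neg ψ))

def PreFormula.iff (φ ψ : PreFormula L n) : PreFormula L n := (φ.imp ψ).and (ψ.imp φ)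

/-! ### Substitution -/

/-- The term with its slots renumbered so as to pass under a quantifier binding `k` variables. -/
def Term.lift (k : ℕ) : Term L n → Term L (k + n)
  | .bvar i => .bvar (Fin.natAdd k i)
  | .fvar x => .fvar x
  | .const c => .const c

/-- Simultaneous substitution of `β i` for the slot `i` and of `ρ x` for the variable `x`. -/
def Term.subst (β : Fin n → Term L m) (ρ : Var.{u} → Term L m) : Term L n → Term L m
  | .bvar i => β i
  | .fvar x => ρ x
  | .const c => .const c

/-- Simultaneous capture-avoiding substitution. -/
def PreFormula.subst : {n m : ℕ} → PreFormula L n → (Fin n → Term L m) → (Var.{u} → Term L m) →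
    PreFormula L m
  | _, _, .eq t s, β, ρ => .eq (t.subst β ρ) (s.subst β ρ)
  | _, _, .rel R t, β, ρ => .rel R (fun i => (t i).subst β ρ)
  | _, _, .neg φ, β, ρ => .neg (φ.subst β ρ)
  | _, _, .conj f, β, ρ => .conj (fun i => (f i).subst β ρ)
  | _, m, .all k φ, β, ρ => .all k (φ.subst
      (Fin.addCases (fun j => .bvar (Fin.castAdd m j)) (fun i => (β i).lift k))
      (fun x => (ρ x).lift k))

/-- `φ(t₀, …, t_{k-1})`: the terms `t` are put into the open slots of `φ`. -/
def PreFormula.inst {k : ℕ} (φ : PreFormula L k) (t : Fin k → Term L 0) : PreFormula L 0 :=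
  φ.subst t .fvar

/-- Replace every free variable `x` by the variable `w x`. -/
def PreFormula.rename (w : Var.{u} → Var.{u}) (φ : PreFormula L 0) : PreFormula L 0 :=
  φ.subst .bvar (fun x => .fvar (w x))

/-! ### The sequent calculus -/

/-- The sequents `Γ ⊢ Δ` of the calculus: `Γ` and `Δ` are set-sized collections of formulae. -/
structure IsSequent (Γ Δ : Set (PreFormula L 0)) : Prop where
  small_left : Small.{u} Γ
  small_right : Small.{u} Δ
  left : ∀ φ ∈ Γ, φ.IsFormula
  right : ∀ φ ∈ Δ, φ.IsFormula

/-- `Derivable Γ Δ`: the sequent `Γ ⊢ Δ` has a proof in the infinitary sequent calculus. The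
hypothesis `IsSequent` is stated in the rules where it does not follow from the premises. -/
inductive Derivable : Set (PreFormula L 0) → Set (PreFormula L 0) → Prop
  | ax {Γ Δ} (φ : PreFormula L 0) (hs : IsSequent (insert φ Γ) (insert φ Δ)) :
      Derivable (insert φ Γ) (insert φ Δ)
  | cut {Γ Δ Γ' Δ'} (φ : PreFormula L 0) (h₁ : Derivable (insert φ Γ) Δ)
      (h₂ : Derivable Γ' (insert φ Δ')) : Derivable (Γ ∪ Γ') (Δ ∪ Δ')
  | substitution {Γ Δ} (w : Var.{u} → Var.{u}) (h : Derivable Γ Δ) :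
      Derivable (PreFormula.rename w '' Γ) (PreFormula.rename w '' Δ)
  | weakening {Γ Δ Γ' Δ'} (hs : IsSequent Γ' Δ') (h : Derivable Γ Δ) :
      Derivable (Γ ∪ Γ') (Δ ∪ Δ')
  | negLeft {Γ Δ} {φ : PreFormula L 0} (h : Derivable Γ (insert φ Δ)) :
      Derivable (insert (.neg φ) Γ) Δ
  | negRight {Γ Δ} {φ : PreFormula L 0} (h : Derivable (insert φ Γ) Δ) :
      Derivable Γ (insert (.neg φ) Δ)
  | conjLeft {Γ Δ} {ι : Type u} (f : ι → PreFormula L 0)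
      (hs : IsSequent (insert (.conj f) Γ) Δ) (h : Derivable (Γ ∪ Set.range f) Δ) :
      Derivable (insert (.conj f) Γ) Δ
  | conjRight {Γ Δ} {ι : Type u} (f : ι → PreFormula L 0)
      (hs : IsSequent Γ (insert (.conj f) Δ)) (h : ∀ i, Derivable Γ (insert (f i) Δ)) :
      Derivable Γ (insert (.conj f) Δ)
  | allLeft {Γ Δ} {k : ℕ} (φ : PreFormula L k) (t : Fin k → Term L 0)
      (h : Derivable (insert (φ.inst t) Γ) Δ) : Derivable (insert (.all k φ) Γ) Δ
  | allRight {Γ Δ} {k : ℕ} (φ : PreFormula L k) (w : Fin k → Var.{u})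
      (hw : Function.Injective w) (hφ : ∀ i, w i ∉ φ.freeVars)
      (hΓ : ∀ i, ∀ ψ ∈ Γ, w i ∉ ψ.freeVars) (hΔ : ∀ i, ∀ ψ ∈ Δ, w i ∉ ψ.freeVars)
      (h : Derivable Γ (insert (φ.inst (fun i => .fvar (w i))) Δ)) :
      Derivable Γ (insert (.all k φ) Δ)
  | eqRefl (t : Term L 0) : Derivable ∅ {.eq t t}
  | eqSymm (x y : Var.{u}) : Derivable {.eq (.fvar x) (.fvar y)} {.eq (.fvar y) (.fvar x)}
  | eqSubst {k : ℕ} (φ : PreFormula L k) (hφ : φ.IsFormula) (u t : Fin k → Term L 0) :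
      Derivable (insert (φ.inst t) (Set.range fun i => .eq (u i) (t i))) {φ.inst u}

/-! ### Boolean valued models -/

/-- A `B`-valued model for `L` with domain `M`. -/
@[ext]
structure BVModel (L : Signature.{u}) (B : Type u) [CompleteBooleanAlgebra B] (M : Type u) where
  nonempty : Nonempty M
  /-- the Boolean value of equality -/
  eqv : M → M → B
  /-- the Boolean value of `R(τ₀, …)` -/
  rel : (R : L.Rel) → (Fin (L.arity R) → M) → B
  /-- the interpretation of the constant symbols -/
  const : L.Const → M
  eqv_refl : ∀ τ, eqv τ τ = ⊤
  eqv_symm : ∀ τ σ, eqv τ σ = eqv σ τ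
  eqv_trans : ∀ τ σ π, eqv τ σ ⊓ eqv σ π ≤ eqv τ π
  rel_congr : ∀ R (τ σ : Fin (L.arity R) → M), (⨅ i, eqv (τ i) (σ i)) ⊓ rel R τ ≤ rel R σ

variable {B : Type u} [CompleteBooleanAlgebra B] {M : Type u}

/-- The value of a term, with `a` the values of the free variables and `e` those of the slots. -/
def Term.eval (N : BVModel L B M) (a : Var.{u} → M) (e : Fin n → M) : Term L n → M
  | .bvar i => e i
  | .fvar x => a x
  | .const c => N.const c

/-- The Boolean value of a pre-formula. -/
def PreFormula.eval (N : BVModel L B M) (a : Var.{u} → M) :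
    {n : ℕ} → PreFormula L n → (Fin n → M) → B
  | _, .eq t s, e => N.eqv (t.eval N a e) (s.eval N a e)
  | _, .rel R t, e => N.rel R (fun i => (t i).eval N a e)
  | _, .neg φ, e => (φ.eval N a e)ᶜ
  | _, .conj f, e => ⨅ i, (f i).eval N a e
  | _, .all k φ, e => ⨅ b : Fin k → M, φ.eval N a (Fin.append b e)

/-- `N ⊨ T`: all members of `T` have value `1`. -/
def BVModel.Models (N : BVModel L B M) (T : Set (PreFormula L 0)) : Prop :=
  ∀ φ ∈ T, ∀ a : Var.{u} → M, φ.eval N a Fin.elim0 = ⊤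

/-- The restriction to `L` of a model for `L ∪ {R}`. -/
def BVModel.reduct {k : ℕ} (N : BVModel (L.adjoin k) B M) : BVModel L B M where
  nonempty := N.nonempty
  eqv := N.eqv
  rel := fun R => N.rel (some R)
  const := N.const
  eqv_refl := N.eqv_refl
  eqv_symm := N.eqv_symm
  eqv_trans := N.eqv_trans
  rel_congr := fun R => N.rel_congr (some R)

/-! ### Beth definability -/

/-- An `L`-term as a term for `L ∪ {R}`. -/
def Term.expand (k : ℕ) : Term L n → Term (L.adjoin k) n
  | .bvar i => .bvar i
  | .fvar x => .fvar x
  | .const c => .const c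

/-- An `L`-formula as a formula for `L ∪ {R}`. -/
def PreFormula.expand (k : ℕ) : {n : ℕ} → PreFormula L n → PreFormula (L.adjoin k) n
  | _, .eq t s => .eq (t.expand k) (s.expand k)
  | _, .rel R t => .rel (L := L.adjoin k) (some R) (fun i => (t i).expand k)
  | _, .neg φ => .neg (φ.expand k)
  | _, .conj f => .conj (fun i => (f i).expand k)
  | _, .all j φ => .all j (φ.expand k)

/-- `R` is implicitly Boolean definable from `T`: its Boolean values in a model of `T` are
determined by the restriction of the model to `L`. -/
def ImplicitlyBooleanDefinable {k : ℕ} (T : Set (PreFormula (L.adjoin k) 0)) : Prop :=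
  ∀ (B : Type u) [CompleteBooleanAlgebra B] (M : Type u) (N₁ N₂ : BVModel (L.adjoin k) B M),
    N₁.Models T → N₂.Models T → N₁.reduct = N₂.reduct →
      ∀ τ : Fin k → M, N₁.rel none τ = N₂.rel none τ

/-- The sentence `∀ v₀ … v_{k-1} (R(v₀, …, v_{k-1}) ↔ φ(v₀, …, v_{k-1}))`. -/
def definingSentence {k : ℕ} (φ : PreFormula L k) : PreFormula (L.adjoin k) 0 :=
  .all k (PreFormula.iff (n := k) (.rel (L := L.adjoin k) none (fun i => .bvar i)) (φ.expand k))

/-- `R` is explicitly Boolean definable from `T` in `L_{∞ω}`. -/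
def ExplicitlyBooleanDefinable {k : ℕ} (T : Set (PreFormula (L.adjoin k) 0)) : Prop :=
  ∃ φ : PreFormula L k, φ.IsSentence ∧ Derivable T {definingSentence φ}

end InfLogic

namespace InfLogic

variable {L : Signature.{u}} {n m l : ℕ}

/-! ### Substitution lemmas -/

/-! Explicit definability implies implicit definability by soundness: in a model of `T`, the value
of `R` is that of the defining formula, which is computed in the reduct to `L`.

For the converse, call two sets of formulae separable if some `L`-formula `θ` follows from the first
and is refuted by the second. If `T ∪ {R(w)}` and `T ∪ {¬R(w)}` are separable, superfluous free
variables of `θ` can be quantified away, and `θ` then defines `R`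
(`ExplicitlyBooleanDefinable.of_separable`). If they are not, two Boolean valued models refuting
implicit definability are built by forcing. Conditions are pairs of finite sets, from a set-sized
fragment, that are not separable over `T`; a condition forces `φ` on one side if adding `¬φ` on that
side makes it separable. Separability obeys the rules this requires: a separator for `¬⋀ f` is the
disjunction of the separators for the `¬ f i`, one for `¬∀ χ` is the existential closure of a
separator for a fresh instance, and there is a cut rule. Hence forcing obeys the usual clauses, and
the regular down-sets of conditions form a complete Boolean algebra in which both sides become
models on the same domain of terms (`eval_termModel`). No generic filter is needed, because the
values stay in the algebra.

Both models satisfy `T`. They agree on `L` because `L`-formulae may be moved across a separable pair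
(`Separable.insert_expand_neg`), so that both sides force the same `L`-formulae. Yet the condition
`({R(w)}, {¬R(w)})` belongs to the value of `R(w)` in the first model and not in the second. -/

theorem Term.lift_subst (t : Term L n) (k : ℕ) (β : Fin n → Term L m) (ρ : Var.{u} → Term L m) :
    (t.lift k).subst (Fin.addCases (fun j => .bvar (Fin.castAdd m j)) (fun i => (β i).lift k))
      (fun x => (ρ x).lift k) = (t.subst β ρ).lift k := by
  cases t <;> simp [Term.lift, Term.subst]

theorem Term.subst_subst (t : Term L n) (β : Fin n → Term L m) (ρ : Var.{u} → Term L m)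
    (β' : Fin m → Term L l) (ρ' : Var.{u} → Term L l) :
    (t.subst β ρ).subst β' ρ' =
      t.subst (fun i => (β i).subst β' ρ') (fun x => (ρ x).subst β' ρ') := by
  cases t <;> rfl

theorem PreFormula.subst_subst (φ : PreFormula L n) (β : Fin n → Term L m)
    (ρ : Var.{u} → Term L m) (β' : Fin m → Term L l) (ρ' : Var.{u} → Term L l) :
    (φ.subst β ρ).subst β' ρ' =
      φ.subst (fun i => (β i).subst β' ρ') (fun x => (ρ x).subst β' ρ') := by
  induction φ generalizing m l with
  | eq t s => simp [PreFormula.subst, Term.subst_subst]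
  | rel R t => simp [PreFormula.subst, Term.subst_subst]
  | neg φ ih => simp [PreFormula.subst, ih]
  | conj f ih => simp [PreFormula.subst, ih]
  | all k φ ih =>
    simp only [PreFormula.subst, ih]
    congr 2
    · funext i
      refine Fin.addCases (fun j => ?_) (fun j => ?_) i
      · simp [Term.subst]
      · simp [Term.lift_subst]
    · funext x
      simp [Term.lift_subst]

theorem PreFormula.subst_congr (φ : PreFormula L n) (β : Fin n → Term L m)
    {ρ ρ' : Var.{u} → Term L m} (h : ∀ x ∈ φ.freeVars, ρ x = ρ' x) :
    φ.subst β ρ = φ.subst β ρ' := by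
  have ht : ∀ {n m : ℕ} (t : Term L n) (β : Fin n → Term L m) {ρ ρ' : Var.{u} → Term L m},
      (∀ x ∈ t.freeVars, ρ x = ρ' x) → t.subst β ρ = t.subst β ρ' := by
    intro n m t β ρ ρ' h
    cases t <;> simp_all [Term.subst, Term.freeVars]
  induction φ generalizing m with
  | eq t s =>
    simp only [PreFormula.subst]
    rw [ht t β fun x hx => h x (Or.inl hx), ht s β fun x hx => h x (Or.inr hx)]
  | rel R t =>
    simp only [PreFormula.subst]
    congr 1
    funext i
    exact ht (t i) β fun x hx => h x (Set.mem_iUnion.2 ⟨i, hx⟩)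
  | neg φ ih => simp only [PreFormula.subst]; rw [ih β h]
  | conj f ih =>
    simp only [PreFormula.subst]
    congr 1
    funext i
    exact ih i β fun x hx => h x (Set.mem_iUnion.2 ⟨i, hx⟩)
  | all k φ ih =>
    simp only [PreFormula.subst]
    congr 1
    exact ih _ fun x hx => by rw [h x hx]

theorem PreFormula.subst_bvar_fvar (φ : PreFormula L n) : φ.subst .bvar .fvar = φ := by
  have ht : ∀ {n : ℕ} (t : Term L n), t.subst .bvar .fvar = t := by
    intro n t; cases t <;> rfl
  induction φ with
  | eq t s => simp [PreFormula.subst, ht]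
  | rel R t => simp [PreFormula.subst, ht]
  | neg φ ih => simp [PreFormula.subst, ih]
  | conj f ih => simp [PreFormula.subst, ih]
  | @all n k φ ih =>
    simp only [PreFormula.subst]
    congr 1
    refine Eq.trans ?_ ih
    congr 1
    funext i
    refine Fin.addCases (fun j => ?_) (fun j => ?_) i <;> simp [Term.lift]

theorem PreFormula.subst_eq_self (φ : PreFormula L n) {ρ : Var.{u} → Term L n}
    (h : ∀ x ∈ φ.freeVars, ρ x = .fvar x) : φ.subst .bvar ρ = φ :=
  (φ.subst_congr _ h).trans φ.subst_bvar_fvar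

theorem Term.freeVars_lift (t : Term L n) (k : ℕ) : (t.lift k).freeVars = t.freeVars := by
  cases t <;> rfl

theorem PreFormula.mem_freeVars_of_subst (φ : PreFormula L n) {β : Fin n → Term L m}
    {ρ : Var.{u} → Term L m} {x : Var.{u}} (hx : x ∈ (φ.subst β ρ).freeVars) :
    (∃ i, x ∈ (β i).freeVars) ∨ ∃ y ∈ φ.freeVars, x ∈ (ρ y).freeVars := by
  have ht : ∀ {n m : ℕ} (t : Term L n) {β : Fin n → Term L m} {ρ : Var.{u} → Term L m},
      x ∈ (t.subst β ρ).freeVars →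
      (∃ i, x ∈ (β i).freeVars) ∨ ∃ y ∈ t.freeVars, x ∈ (ρ y).freeVars := by
    intro n m t β ρ hx
    cases t with
    | bvar i => exact Or.inl ⟨i, hx⟩
    | fvar y => exact Or.inr ⟨y, rfl, hx⟩
    | const c => exact hx.elim
  induction φ generalizing m with
  | eq t s =>
    rcases hx with hx | hx
    · exact (ht t hx).imp_right fun ⟨y, hy, h⟩ => ⟨y, Or.inl hy, h⟩
    · exact (ht s hx).imp_right fun ⟨y, hy, h⟩ => ⟨y, Or.inr hy, h⟩
  | rel R t =>
    obtain ⟨i, hx⟩ := Set.mem_iUnion.1 hx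
    exact (ht (t i) hx).imp_right fun ⟨y, hy, h⟩ => ⟨y, Set.mem_iUnion.2 ⟨i, hy⟩, h⟩
  | neg φ ih => exact ih hx
  | conj f ih =>
    obtain ⟨i, hx⟩ := Set.mem_iUnion.1 hx
    exact (ih i hx).imp_right fun ⟨y, hy, h⟩ => ⟨y, Set.mem_iUnion.2 ⟨i, hy⟩, h⟩
  | all k φ ih =>
    rcases ih hx with ⟨i, hi⟩ | ⟨y, hy, h⟩
    · revert hi
      refine Fin.addCases (fun j => ?_) (fun j => ?_) i
      · simp [Term.freeVars]
      · simp only [Fin.addCases_right, Term.freeVars_lift]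
        exact fun h => Or.inl ⟨j, h⟩
    · exact Or.inr ⟨y, hy, by rwa [Term.freeVars_lift] at h⟩

theorem Term.finite_freeVars (t : Term L n) : t.freeVars.Finite := by
  cases t <;> simp [Term.freeVars]

theorem PreFormula.IsFormula.subst {φ : PreFormula L n} (h : φ.IsFormula) (β : Fin n → Term L m)
    (ρ : Var.{u} → Term L m) : (φ.subst β ρ).IsFormula := by
  refine Set.Finite.subset ((Set.finite_iUnion fun i => (β i).finite_freeVars).union
    (Set.Finite.biUnion h fun y _ => (ρ y).finite_freeVars)) fun x hx => ?_
  rcases φ.mem_freeVars_of_subst hx with ⟨i, hi⟩ | ⟨y, hy, hx⟩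
  · exact Or.inl (Set.mem_iUnion.2 ⟨i, hi⟩)
  · exact Or.inr (Set.mem_iUnion₂.2 ⟨y, hy, hx⟩)

theorem PreFormula.IsFormula.inst {φ : PreFormula L n} (h : φ.IsFormula) (t : Fin n → Term L 0) :
    (φ.inst t).IsFormula := IsFormula.subst h _ _

theorem PreFormula.IsFormula.of_conj {ι : Type u} {f : ι → PreFormula L n}
    (h : (PreFormula.conj f).IsFormula) (i : ι) : (f i).IsFormula :=
  Set.Finite.subset h (Set.subset_iUnion (fun i => (f i).freeVars) i)

theorem PreFormula.IsSentence.isFormula {φ : PreFormula L n} (h : φ.IsSentence) : φ.IsFormula := by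
  unfold IsFormula
  rw [show φ.freeVars = ∅ from h]
  exact Set.finite_empty

/-! ### Expansion of the signature -/

theorem Term.expand_lift (t : Term L n) (k j : ℕ) : (t.lift j).expand k = (t.expand k).lift j := by
  cases t <;> rfl

theorem Term.expand_subst (t : Term L n) (k : ℕ) (β : Fin n → Term L m)
    (ρ : Var.{u} → Term L m) :
    (t.subst β ρ).expand k = (t.expand k).subst (fun i => (β i).expand k)
      (fun x => (ρ x).expand k) := by
  cases t <;> rfl

theorem PreFormula.expand_subst (φ : PreFormula L n) (k : ℕ) (β : Fin n → Term L m)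
    (ρ : Var.{u} → Term L m) :
    (φ.subst β ρ).expand k = (φ.expand k).subst (fun i => (β i).expand k)
      (fun x => (ρ x).expand k) := by
  induction φ generalizing m with
  | eq t s => simp [PreFormula.subst, PreFormula.expand, Term.expand_subst]
  | rel R t => simp [PreFormula.subst, PreFormula.expand, Term.expand_subst]
  | neg φ ih => simp [PreFormula.subst, PreFormula.expand, ih]
  | conj f ih => simp [PreFormula.subst, PreFormula.expand, ih]
  | all j φ ih =>
    simp only [PreFormula.subst, PreFormula.expand, ih, Term.expand_lift]
    congr 2
    funext i
    refine Fin.addCases (fun j => ?_) (fun j => ?_) i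
    · simp [Term.expand]
    · simpa using (β j).expand_lift k _

theorem PreFormula.freeVars_expand (φ : PreFormula L n) (k : ℕ) :
    (φ.expand k).freeVars = φ.freeVars := by
  have ht : ∀ {n : ℕ} (t : Term L n), (t.expand k).freeVars = t.freeVars := by
    intro n t; cases t <;> rfl
  induction φ with
  | eq t s => simp [PreFormula.freeVars, PreFormula.expand, ht]
  | rel R t =>
    show (⋃ i, ((t i).expand k).freeVars) = ⋃ i, (t i).freeVars
    simp [ht]
  | neg φ ih => simpa [PreFormula.freeVars, PreFormula.expand] using ih
  | conj f ih => simp [PreFormula.freeVars, PreFormula.expand, ih]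
  | all j φ ih => simpa [PreFormula.freeVars, PreFormula.expand] using ih

theorem PreFormula.IsFormula.expand {φ : PreFormula L n} (h : φ.IsFormula) (k : ℕ) :
    (φ.expand k).IsFormula := by
  unfold IsFormula
  rwa [PreFormula.freeVars_expand]

/-! ### Boolean values -/

variable {B : Type u} [CompleteBooleanAlgebra B] {M : Type u}

theorem Term.eval_lift (N : BVModel L B M) (a : Var.{u} → M) {k : ℕ} (b : Fin k → M)
    (e : Fin n → M) (t : Term L n) : (t.lift k).eval N a (Fin.append b e) = t.eval N a e := by
  cases t <;> simp [Term.lift, Term.eval]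

theorem Term.eval_subst (N : BVModel L B M) (a : Var.{u} → M) (e : Fin m → M) (t : Term L n)
    (β : Fin n → Term L m) (ρ : Var.{u} → Term L m) :
    (t.subst β ρ).eval N a e =
      t.eval N (fun x => (ρ x).eval N a e) (fun i => (β i).eval N a e) := by
  cases t <;> rfl

theorem PreFormula.eval_subst (N : BVModel L B M) (a : Var.{u} → M) (e : Fin m → M)
    (φ : PreFormula L n) (β : Fin n → Term L m) (ρ : Var.{u} → Term L m) :
    (φ.subst β ρ).eval N a e =
      φ.eval N (fun x => (ρ x).eval N a e) (fun i => (β i).eval N a e) := by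
  induction φ generalizing m with
  | eq t s => simp [PreFormula.subst, PreFormula.eval, Term.eval_subst]
  | rel R t => simp [PreFormula.subst, PreFormula.eval, Term.eval_subst]
  | neg φ ih => simp [PreFormula.subst, PreFormula.eval, ih]
  | conj f ih => simp [PreFormula.subst, PreFormula.eval, ih]
  | all k φ ih =>
    simp only [PreFormula.subst, PreFormula.eval, ih, Term.eval_lift]
    refine iInf_congr fun b => ?_
    congr 1
    funext i
    refine Fin.addCases (fun j => ?_) (fun j => ?_) i
    · simp [Term.eval]
    · simp [Term.eval_lift]

theorem Term.eval_congr (N : BVModel L B M) {a a' : Var.{u} → M} (e : Fin n → M) (t : Term L n)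
    (h : ∀ x ∈ t.freeVars, a x = a' x) : t.eval N a e = t.eval N a' e := by
  cases t <;> simp_all [Term.eval, Term.freeVars]

theorem PreFormula.eval_congr (N : BVModel L B M) {a a' : Var.{u} → M} (φ : PreFormula L n)
    (e : Fin n → M) (h : ∀ x ∈ φ.freeVars, a x = a' x) : φ.eval N a e = φ.eval N a' e := by
  induction φ with
  | eq t s =>
    simp only [PreFormula.eval]
    rw [t.eval_congr N e fun x hx => h x (Or.inl hx), s.eval_congr N e fun x hx => h x (Or.inr hx)]
  | rel R t =>
    simp only [PreFormula.eval]
    congr 1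
    funext i
    exact (t i).eval_congr N e fun x hx => h x (Set.mem_iUnion.2 ⟨i, hx⟩)
  | neg φ ih => simp only [PreFormula.eval]; rw [ih e h]
  | conj f ih =>
    exact iInf_congr fun i => ih i e fun x hx => h x (Set.mem_iUnion.2 ⟨i, hx⟩)
  | all k φ ih => exact iInf_congr fun b => ih _ h

theorem PreFormula.eval_inst (N : BVModel L B M) (a : Var.{u} → M) (φ : PreFormula L n)
    (t : Fin n → Term L 0) :
    (φ.inst t).eval N a Fin.elim0 = φ.eval N a (fun i => (t i).eval N a Fin.elim0) :=
  φ.eval_subst N a _ _ _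

theorem BVModel.eqv_congr (N : BVModel L B M) (τ τ' σ σ' : M) :
    N.eqv τ τ' ⊓ N.eqv σ σ' ⊓ N.eqv τ σ ≤ N.eqv τ' σ' := by
  have h₁ : N.eqv τ τ' ⊓ N.eqv σ σ' ⊓ N.eqv τ σ ≤ N.eqv τ' σ := by
    refine le_trans ?_ (N.eqv_trans τ' τ σ)
    rw [N.eqv_symm τ' τ]
    exact inf_le_inf_right _ inf_le_left
  refine le_trans (le_inf h₁ ?_) (N.eqv_trans τ' σ σ')
  exact inf_le_left.trans inf_le_right

/-- This is the semantic content of the rule `eqSubst`. The negation step applies the induction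
hypothesis with the two tuples exchanged; the quantifier step pads the tuples with entries equal to
themselves. -/
theorem PreFormula.iInf_eqv_inf_eval_le (N : BVModel L B M) (a : Var.{u} → M) (φ : PreFormula L n)
    (e e' : Fin n → M) : (⨅ i, N.eqv (e i) (e' i)) ⊓ φ.eval N a e ≤ φ.eval N a e' := by
  have ht : ∀ {n : ℕ} (t : Term L n) (e e' : Fin n → M),
      (⨅ i, N.eqv (e i) (e' i)) ≤ N.eqv (t.eval N a e) (t.eval N a e') := by
    intro n t e e'
    cases t with
    | bvar i => exact iInf_le _ i
    | fvar x => simp [Term.eval, N.eqv_refl]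
    | const c => simp [Term.eval, N.eqv_refl]
  induction φ with
  | eq t s =>
    exact le_trans (inf_le_inf_right _ (le_inf (ht t e e') (ht s e e'))) (N.eqv_congr _ _ _ _)
  | rel R t =>
    exact le_trans (inf_le_inf_right _ (le_iInf fun i => ht (t i) e e')) (N.rel_congr R _ _)
  | neg φ ih =>
    have h := ih e' e
    simp only [PreFormula.eval]
    simp_rw [N.eqv_symm (e' _) (e _)] at h
    rw [le_compl_iff_disjoint_right, disjoint_iff_inf_le]
    calc _ ≤ ((⨅ i, N.eqv (e i) (e' i)) ⊓ φ.eval N a e') ⊓ (φ.eval N a e)ᶜ :=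
          le_inf (le_inf (inf_le_left.trans inf_le_left) inf_le_right)
            (inf_le_left.trans inf_le_right)
      _ ≤ φ.eval N a e ⊓ (φ.eval N a e)ᶜ := inf_le_inf_right _ h
      _ ≤ ⊥ := by rw [inf_compl_eq_bot]
  | conj f ih =>
    exact le_iInf fun i => le_trans (inf_le_inf_left _ (iInf_le _ i)) (ih i e e')
  | all k φ ih =>
    refine le_iInf fun b => le_trans (inf_le_inf ?_ (iInf_le _ b)) (ih (Fin.append b e) _)
    refine le_iInf fun i => ?_
    refine Fin.addCases (fun j => ?_) (fun j => ?_) i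
    · simp [N.eqv_refl]
    · simpa using iInf_le _ j

theorem Term.eval_expand {k : ℕ} (N : BVModel (L.adjoin k) B M) (a : Var.{u} → M) (e : Fin n → M)
    (t : Term L n) : (t.expand k).eval N a e = t.eval N.reduct a e := by
  cases t <;> rfl

theorem PreFormula.eval_expand {k : ℕ} (N : BVModel (L.adjoin k) B M) (a : Var.{u} → M)
    (φ : PreFormula L n) (e : Fin n → M) :
    (φ.expand k).eval N a e = φ.eval N.reduct a e := by
  induction φ with
  | eq t s =>
    simp only [PreFormula.expand, PreFormula.eval, Term.eval_expand]
    rfl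
  | rel R t =>
    simp only [PreFormula.expand, PreFormula.eval]
    show N.rel (some R) _ = N.rel (some R) _
    congr 1
    funext i
    exact Term.eval_expand N a e (t i)
  | neg φ ih => simp only [PreFormula.expand, PreFormula.eval, ih]
  | conj f ih => simp only [PreFormula.expand, PreFormula.eval, ih]
  | all j φ ih => simp only [PreFormula.expand, PreFormula.eval, ih]

theorem PreFormula.eval_and (N : BVModel L B M) (a : Var.{u} → M) (e : Fin n → M)
    (φ ψ : PreFormula L n) : (φ.and ψ).eval N a e = φ.eval N a e ⊓ ψ.eval N a e := by
  refine le_antisymm (le_inf (iInf_le_of_le ⟨true⟩ le_rfl) (iInf_le_of_le ⟨false⟩ le_rfl)) ?_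
  refine le_iInf fun b => ?_
  rcases b with ⟨_ | _⟩
  · exact inf_le_right
  · exact inf_le_left

theorem PreFormula.eval_iff_eq_top (N : BVModel L B M) (a : Var.{u} → M) (e : Fin n → M)
    (φ ψ : PreFormula L n) : (φ.iff ψ).eval N a e = ⊤ ↔ φ.eval N a e = ψ.eval N a e := by
  simp only [PreFormula.iff, PreFormula.imp, eval_and, PreFormula.eval]
  rw [inf_eq_top_iff, compl_eq_top, compl_eq_top, ← sdiff_eq, ← sdiff_eq, sdiff_eq_bot_iff,
    sdiff_eq_bot_iff]
  exact le_antisymm_iff.symm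

/-! ### Soundness -/

/-- Every derivable sequent is valid in every Boolean valued model. -/
theorem Derivable.sound {Γ Δ : Set (PreFormula L 0)} (h : Derivable Γ Δ) (N : BVModel L B M)
    (a : Var.{u} → M) :
    (⨅ φ ∈ Γ, φ.eval N a Fin.elim0) ≤ ⨆ φ ∈ Δ, φ.eval N a Fin.elim0 := by
  induction h generalizing a with
  | ax φ _ =>
    rw [iInf_insert, iSup_insert]
    exact inf_le_left.trans le_sup_left
  | cut φ _ _ ih₁ ih₂ =>
    have h₁ := ih₁ a
    have h₂ := ih₂ a
    rw [iInf_insert] at h₁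
    rw [iSup_insert] at h₂
    rw [iInf_union, iSup_union]
    refine (le_inf inf_le_left (inf_le_right.trans h₂)).trans ?_
    rw [inf_sup_left]
    refine sup_le_sup ?_ inf_le_right
    rw [inf_comm]
    exact h₁
  | substitution w _ ih =>
    -- Renaming variables amounts to precomposing the assignment with `w`.
    have hr : ∀ φ : PreFormula L 0, (φ.rename w).eval N a Fin.elim0 =
        φ.eval N (fun x => a (w x)) Fin.elim0 := fun φ =>
      (φ.eval_subst N a _ _ _).trans (by congr 1)
    rw [iInf_image, iSup_image]
    simp only [hr]
    exact ih _
  | weakening _ _ ih =>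
    rw [iInf_union, iSup_union]
    exact inf_le_left.trans ((ih a).trans le_sup_left)
  | negLeft _ ih =>
    have h := ih a
    rw [iSup_insert] at h
    rw [iInf_insert]
    simp only [PreFormula.eval]
    rw [inf_comm, ← sdiff_eq, sdiff_le_iff]
    exact h
  | negRight _ ih =>
    have h := ih a
    rw [iInf_insert, inf_comm] at h
    rw [iSup_insert]
    simp only [PreFormula.eval]
    rw [sup_comm, ← himp_eq, le_himp_iff]
    exact h
  | conjLeft f _ _ ih =>
    have h := ih a
    rw [iInf_union, iInf_range] at h
    rw [iInf_insert, inf_comm]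
    exact h
  | conjRight f _ _ ih =>
    rw [iSup_insert]
    simp only [PreFormula.eval]
    -- The side formulae in `Δ` are absorbed by the distributive law for infima, available since the
    -- algebra is a complete Boolean one.
    rw [iInf_sup_eq]
    refine le_iInf fun i => ?_
    have h := ih i a
    rwa [iSup_insert] at h
  | allLeft φ t _ ih =>
    have h := ih a
    rw [iInf_insert, PreFormula.eval_inst] at h
    rw [iInf_insert]
    refine le_trans (inf_le_inf_right _ ?_) h
    simp only [PreFormula.eval]
    refine (iInf_le _ fun i => (t i).eval N a Fin.elim0).trans (le_of_eq ?_)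
    congr 1
    exact Fin.append_elim0 _
  | @allRight Γ Δ k φ w hw hφ hΓ hΔ _ ih =>
    rw [iSup_insert]
    simp only [PreFormula.eval]
    rw [iInf_sup_eq]
    refine le_iInf fun b => ?_
    -- The eigenvariables `w` receive the values `b`; as they occur neither in `Γ`, `Δ` nor in `φ`,
    -- all other values are unchanged.
    let a' : Var.{u} → M := Function.extend w b a
    have ha' : ∀ x, (∀ i, w i ≠ x) → a x = a' x := fun x hx =>
      (Function.extend_apply' _ _ _ (by rintro ⟨i, hi⟩; exact hx i hi)).symm
    have h := ih a'
    rw [iSup_insert, PreFormula.eval_inst] at h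
    have h₁ : ∀ ψ ∈ Γ, ψ.eval N a Fin.elim0 = ψ.eval N a' Fin.elim0 := fun ψ hψ =>
      ψ.eval_congr N _ fun x hx => ha' x fun i hi => hΓ i ψ hψ (hi ▸ hx)
    have h₂ : ∀ ψ ∈ Δ, ψ.eval N a Fin.elim0 = ψ.eval N a' Fin.elim0 := fun ψ hψ =>
      ψ.eval_congr N _ fun x hx => ha' x fun i hi => hΔ i ψ hψ (hi ▸ hx)
    rw [biInf_congr h₁, biSup_congr h₂]
    refine h.trans (le_of_eq ?_)
    congr 1
    rw [φ.eval_congr N _ fun x hx => ha' x fun i hi => hφ i (hi ▸ hx)]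
    congr 1
    refine Eq.trans ?_ (Fin.append_elim0 _).symm
    funext i
    exact hw.extend_apply b a i
  | eqRefl t => simp [PreFormula.eval, N.eqv_refl]
  | eqSymm x y =>
    simp only [Set.mem_singleton_iff, iInf_iInf_eq_left, iSup_iSup_eq_left, PreFormula.eval]
    rw [N.eqv_symm]
  | eqSubst φ _ v t =>
    rw [iInf_insert, iInf_range]
    simp only [Set.mem_singleton_iff, iSup_iSup_eq_left, PreFormula.eval_inst, PreFormula.eval]
    refine le_trans (le_of_eq ?_) (φ.iInf_eqv_inf_eval_le N a (fun i => (t i).eval N a Fin.elim0) _)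
    rw [inf_comm]
    congr 1
    exact iInf_congr fun i => N.eqv_symm _ _

/-- All premises have value `⊤` in a model of `T`, so by soundness the defining sentence does too;
this fixes `R` in terms of the reduct. -/
theorem ExplicitlyBooleanDefinable.implicitly {k : ℕ} {T : Set (PreFormula (L.adjoin k) 0)}
    (h : ExplicitlyBooleanDefinable T) : ImplicitlyBooleanDefinable T := by
  obtain ⟨φ, hφ, hd⟩ := h
  intro B _ M N₁ N₂ h₁ h₂ hr τ
  have key : ∀ N : BVModel (L.adjoin k) B M, N.Models T → ∀ a : Var.{u} → M,
      N.rel none τ = φ.eval N.reduct a τ := by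
    intro N hN a
    have h := hd.sound N a
    rw [biInf_congr fun ψ hψ => hN ψ hψ a] at h
    simp only [Set.mem_singleton_iff, iSup_iSup_eq_left, iInf_top, top_le_iff, definingSentence,
      PreFormula.eval] at h
    have h := (iInf_eq_top.1 h) τ
    rw [show Fin.append τ Fin.elim0 = τ from Fin.append_elim0 _] at h
    have h := (PreFormula.eval_iff_eq_top N a τ _ _).1 h
    rw [PreFormula.eval_expand] at h
    exact h
  have := N₁.nonempty
  obtain ⟨c⟩ := this
  rw [key N₁ h₁ fun _ => c, key N₂ h₂ fun _ => c, hr]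

end InfLogic

namespace InfLogic

variable {L : Signature.{u}} {n m : ℕ} {Γ Δ Γ' Δ' : Set (PreFormula L 0)} {φ ψ : PreFormula L 0}

/-! ### Inconsistent sets of formulae -/

/-- A set-sized collection of formulae. -/
structure IsContext (Γ : Set (PreFormula L 0)) : Prop where
  small : Small.{u} Γ
  isFormula : ∀ φ ∈ Γ, φ.IsFormula

theorem IsContext.isSequent (h : IsContext Γ) (h' : IsContext Δ) : IsSequent Γ Δ :=
  ⟨h.small, h'.small, h.isFormula, h'.isFormula⟩

theorem IsContext.empty : IsContext (∅ : Set (PreFormula L 0)) :=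
  ⟨inferInstance, by simp⟩

theorem IsContext.mono (h : IsContext Γ) (hΔ : Δ ⊆ Γ) : IsContext Δ :=
  ⟨have := h.small; small_subset hΔ, fun φ hφ => h.isFormula φ (hΔ hφ)⟩

theorem IsContext.of_insert (h : IsContext (insert φ Γ)) : IsContext Γ :=
  h.mono (Set.subset_insert _ _)

theorem IsContext.insert (hφ : φ.IsFormula) (h : IsContext Γ) : IsContext (insert φ Γ) :=
  ⟨have := h.small; inferInstance, by
    rintro ψ (rfl | hψ)
    exacts [hφ, h.isFormula ψ hψ]⟩

theorem IsContext.union (h : IsContext Γ) (h' : IsContext Δ) : IsContext (Γ ∪ Δ) :=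
  ⟨have := h.small; have := h'.small; inferInstance, by
    rintro ψ (hψ | hψ)
    exacts [h.isFormula ψ hψ, h'.isFormula ψ hψ]⟩

theorem IsContext.of_finite (h : Γ.Finite) (hΓ : ∀ φ ∈ Γ, φ.IsFormula) : IsContext Γ :=
  ⟨have := h.to_subtype; Countable.toSmall _, hΓ⟩

theorem Derivable.mono (h : Derivable Γ Δ) (hΓ : Γ ⊆ Γ') (hΔ : Δ ⊆ Δ') (h₁ : IsContext Γ')
    (h₂ : IsContext Δ') : Derivable Γ' Δ' := by
  simpa [Set.union_eq_self_of_subset_left hΓ, Set.union_eq_self_of_subset_left hΔ] using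
    h.weakening (h₁.isSequent h₂)

/-- A cut on `¬φ` against the excluded middle `⊢ ¬φ, φ`. -/
theorem Derivable.of_neg_left (h : Derivable (insert φ.neg Γ) Δ) (hφ : φ.IsFormula)
    (h₁ : IsContext Γ) (h₂ : IsContext Δ) : Derivable Γ (insert φ Δ) := by
  have h' : Derivable Γ (insert φ.neg (insert φ Δ)) :=
    (Derivable.ax φ ((h₁.insert hφ).isSequent (h₂.insert hφ))).negRight
  exact (h.cut φ.neg h').mono (by simp) (by simp) h₁ (h₂.insert hφ)

theorem PreFormula.freeVars_and (φ ψ : PreFormula L n) :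
    (φ.and ψ).freeVars = φ.freeVars ∪ ψ.freeVars := by
  ext x
  simp only [PreFormula.and, PreFormula.freeVars, Set.mem_iUnion, Set.mem_union]
  constructor
  · rintro ⟨⟨_ | _⟩, h⟩
    exacts [Or.inr h, Or.inl h]
  · rintro (h | h)
    exacts [⟨⟨true⟩, h⟩, ⟨⟨false⟩, h⟩]

theorem PreFormula.IsFormula.and {φ ψ : PreFormula L n} (h : φ.IsFormula)
    (h' : ψ.IsFormula) : (φ.and ψ).IsFormula := by
  unfold IsFormula
  rw [freeVars_and]
  exact Set.Finite.union h h'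

/-- `Γ` is a set-sized collection of formulae with `Γ ⊢`. -/
structure Inconsistent (Γ : Set (PreFormula L 0)) : Prop where
  isContext : IsContext Γ
  derivable : Derivable Γ ∅

namespace Inconsistent

theorem mono (h : Inconsistent Γ) (hΓ : Γ ⊆ Γ') (h' : IsContext Γ') : Inconsistent Γ' :=
  ⟨h', h.derivable.mono hΓ subset_rfl h' .empty⟩

theorem of_mem (h : IsContext Γ) (h₁ : φ ∈ Γ) (h₂ : φ.neg ∈ Γ) : Inconsistent Γ := by
  refine ⟨h, ?_⟩
  have hφ := h.isFormula φ h₁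
  have := (Derivable.ax φ ((h.insert hφ).isSequent (IsContext.empty.insert hφ))).negLeft
  exact this.mono (by simp [h₁, h₂]) subset_rfl h .empty

theorem neg_neg (h : Inconsistent (insert φ Γ)) : Inconsistent (insert φ.neg.neg Γ) :=
  ⟨h.isContext.of_insert.insert (h.isContext.isFormula φ (Set.mem_insert _ _)),
    h.derivable.negRight.negLeft⟩

theorem derivable_of_neg (h : Inconsistent (insert φ.neg Γ)) : Derivable Γ {φ} := by
  simpa using h.derivable.of_neg_left (h.isContext.isFormula φ.neg (Set.mem_insert _ _))
    h.isContext.of_insert .empty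

theorem of_derivable (hΓ : IsContext Γ) (hφ : φ.IsFormula) (h : Derivable Γ {φ}) :
    Inconsistent (insert φ.neg Γ) :=
  ⟨hΓ.insert hφ, Derivable.negLeft (by simpa using h)⟩

theorem cut (h : Inconsistent (insert φ Γ)) (h' : Inconsistent (insert φ.neg Γ)) :
    Inconsistent Γ :=
  ⟨h.isContext.of_insert, by
    simpa using h.derivable.cut φ (Δ' := ∅) (Γ' := Γ) (by simpa using h'.derivable_of_neg)⟩

theorem conj {ι : Type u} {f : ι → PreFormula L 0} (hf : (PreFormula.conj f).IsFormula)
    (hΓ : IsContext Γ) (h : Inconsistent (Γ ∪ Set.range f)) :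
    Inconsistent (insert (.conj f) Γ) :=
  ⟨hΓ.insert hf, .conjLeft f ((hΓ.insert hf).isSequent .empty) h.derivable⟩

theorem neg_conj {ι : Type u} {f : ι → PreFormula L 0} (hf : (PreFormula.conj f).IsFormula)
    (hΓ : IsContext Γ) (h : ∀ i, Inconsistent (insert (f i).neg Γ)) :
    Inconsistent (insert (PreFormula.conj f).neg Γ) :=
  ⟨hΓ.insert hf, .negLeft (.conjRight f (hΓ.isSequent (IsContext.empty.insert hf)) fun i => by
    simpa using (h i).derivable_of_neg)⟩

theorem and (h : Inconsistent (insert φ (insert ψ Γ))) : Inconsistent (insert (φ.and ψ) Γ) := by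
  have hΓ := h.isContext.of_insert.of_insert
  have hφ := h.isContext.isFormula φ (by simp)
  have hψ := h.isContext.isFormula ψ (by simp)
  refine conj (hφ.and hψ) hΓ ?_
  refine h.mono ?_ (hΓ.union ((IsContext.of_finite (Set.finite_range _)) ?_))
  · rintro χ (rfl | rfl | hχ)
    · exact Or.inr ⟨⟨true⟩, rfl⟩
    · exact Or.inr ⟨⟨false⟩, rfl⟩
    · exact Or.inl hχ
  · rintro _ ⟨⟨_ | _⟩, rfl⟩
    exacts [hψ, hφ]

theorem neg_and (h : Inconsistent (insert φ.neg Γ)) (h' : Inconsistent (insert ψ.neg Γ)) :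
    Inconsistent (insert (φ.and ψ).neg Γ) := by
  have hφ : φ.IsFormula := h.isContext.isFormula φ.neg (by simp)
  have hψ : ψ.IsFormula := h'.isContext.isFormula ψ.neg (by simp)
  refine neg_conj (hφ.and hψ) h.isContext.of_insert fun b => ?_
  rcases b with ⟨_ | _⟩
  exacts [h', h]

theorem all {χ : PreFormula L n} (hχ : χ.IsFormula) (t : Fin n → Term L 0)
    (h : Inconsistent (insert (χ.inst t) Γ)) : Inconsistent (insert (.all n χ) Γ) :=
  ⟨h.isContext.of_insert.insert hχ, .allLeft χ t h.derivable⟩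

theorem neg_all {χ : PreFormula L n} (hχ : χ.IsFormula) {w : Fin n → Var.{u}}
    (hw : Function.Injective w) (hwχ : ∀ i, w i ∉ χ.freeVars)
    (hwΓ : ∀ i, ∀ ψ ∈ Γ, w i ∉ ψ.freeVars)
    (h : Inconsistent (insert (χ.inst fun i => .fvar (w i)).neg Γ)) :
    Inconsistent (insert (PreFormula.all n χ).neg Γ) :=
  ⟨h.isContext.of_insert.insert hχ, .negLeft (.allRight χ w hw hwχ hwΓ (by simp)
    (by simpa using h.derivable_of_neg))⟩

end Inconsistent

/-! ### Binding free variables -/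

open Classical in
/-- Turn the free variables `w i` into open slots. -/
noncomputable def PreFormula.bind (w : Fin n → Var.{u}) (φ : PreFormula L 0) : PreFormula L n :=
  φ.subst Fin.elim0 fun x => if h : ∃ i, w i = x then .bvar h.choose else .fvar x

/-- Injectivity of `w` is not needed: whichever index is chosen for `x`, its variable is `x` again.
-/
theorem PreFormula.bind_inst (w : Fin n → Var.{u}) (φ : PreFormula L 0) :
    (φ.bind w).inst (fun i => .fvar (w i)) = φ := by
  unfold bind inst
  rw [subst_subst]
  refine Eq.trans ?_ φ.subst_bvar_fvar
  congr 1
  · funext i; exact i.elim0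
  · funext x
    split_ifs with h
    · exact congrArg _ h.choose_spec
    · rfl

theorem PreFormula.mem_freeVars_bind {w : Fin n → Var.{u}} {φ : PreFormula L 0} {x : Var.{u}}
    (hx : x ∈ (φ.bind w).freeVars) : x ∈ φ.freeVars ∧ ∀ i, w i ≠ x := by
  rcases φ.mem_freeVars_of_subst hx with ⟨i, -⟩ | ⟨y, hy, h⟩
  · exact i.elim0
  · split_ifs at h with h'
    · exact h.elim
    · obtain rfl : x = y := h
      exact ⟨hy, fun i hi => h' ⟨i, hi⟩⟩

theorem PreFormula.IsFormula.bind (h : φ.IsFormula) (w : Fin n → Var.{u}) :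
    (φ.bind w).IsFormula := IsFormula.subst h _ _

theorem PreFormula.expand_inst {k : ℕ} (φ : PreFormula L n) (w : Fin n → Var.{u}) :
    (φ.expand k).inst (fun i => .fvar (w i)) = (φ.inst fun i => .fvar (w i)).expand k :=
  (φ.expand_subst k (fun i => .fvar (w i)) .fvar).symm

theorem PreFormula.expand_bind_inst {k : ℕ} (φ : PreFormula L 0) (w : Fin n → Var.{u}) :
    ((φ.bind w).expand k).inst (fun i => .fvar (w i)) = φ.expand k := by
  rw [expand_inst, bind_inst]

theorem PreFormula.expand_and {k : ℕ} (φ ψ : PreFormula L n) :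
    (φ.and ψ).expand k = (φ.expand k).and (ψ.expand k) := by
  simp only [PreFormula.and, PreFormula.expand]
  congr 1
  funext b
  split_ifs <;> rfl

theorem PreFormula.subst_and (φ ψ : PreFormula L n) (β : Fin n → Term L m)
    (ρ : Var.{u} → Term L m) :
    (φ.and ψ).subst β ρ = (φ.subst β ρ).and (ψ.subst β ρ) := by
  simp only [PreFormula.and, PreFormula.subst]
  congr 1
  funext b
  split_ifs <;> rfl

/-! ### Separation by formulae of the smaller signature -/

variable {k : ℕ} {Γ Δ Γ' Δ' : Set (PreFormula (L.adjoin k) 0)} {φ ψ : PreFormula (L.adjoin k) 0}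

/-- Some `L`-formula `θ` satisfies `Γ ⊢ θ` and `Δ, θ ⊢`. -/
def Separable (Γ Δ : Set (PreFormula (L.adjoin k) 0)) : Prop :=
  ∃ θ : PreFormula L 0, θ.IsFormula ∧ Inconsistent (insert (θ.expand k).neg Γ) ∧
    Inconsistent (insert (θ.expand k) Δ)

namespace Separable

/-- The negated separator separates in the opposite direction. -/
theorem symm (h : Separable Γ Δ) : Separable Δ Γ := by
  obtain ⟨θ, hθ, h₁, h₂⟩ := h
  exact ⟨θ.neg, hθ, h₂.neg_neg, h₁⟩

theorem context_left (h : Separable Γ Δ) : IsContext Γ := by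
  obtain ⟨θ, -, h₁, -⟩ := h
  exact h₁.isContext.of_insert

theorem context_right (h : Separable Γ Δ) : IsContext Δ := h.symm.context_left

theorem mono (h : Separable Γ Δ) (hΓ : Γ ⊆ Γ') (hΔ : Δ ⊆ Δ') (h₁ : IsContext Γ')
    (h₂ : IsContext Δ') : Separable Γ' Δ' := by
  obtain ⟨θ, hθ, h₁', h₂'⟩ := h
  exact ⟨θ, hθ, h₁'.mono (Set.insert_subset_insert hΓ) (h₁.insert (hθ.expand k)),
    h₂'.mono (Set.insert_subset_insert hΔ) (h₂.insert (hθ.expand k))⟩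

/-- Falsity, in the form `¬⋀∅`, is a separator. -/
theorem of_inconsistent (h : Inconsistent Γ) (hΔ : IsContext Δ) : Separable Γ Δ := by
  have hf : (PreFormula.conj (fun i : PEmpty.{u + 1} => (i.elim : PreFormula L 0))).IsFormula :=
    Set.finite_iUnion fun i => i.elim
  have hf' := hf.expand k
  exact ⟨(PreFormula.conj fun i : PEmpty.{u + 1} => i.elim).neg, hf,
    h.mono (Set.subset_insert _ _) (h.isContext.insert hf'),
    Inconsistent.neg_conj hf' hΔ fun i => i.elim⟩

/-- The separator stays the same, by a cut on `φ`. This makes forcing closed under consequences. -/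
theorem of_inconsistent_insert (h : Separable (insert φ.neg Γ) Δ)
    (h' : Inconsistent (insert φ (insert ψ.neg Γ))) : Separable (insert ψ.neg Γ) Δ := by
  obtain ⟨θ, hθ, h₁, h₂⟩ := h
  have hΓ := h'.isContext.of_insert.insert (φ := (θ.expand k).neg) (hθ.expand k)
  have hφ := h'.isContext.isFormula φ (by simp)
  refine ⟨θ, hθ, .cut (φ := φ) (h'.mono ?_ (hΓ.insert hφ)) (h₁.mono ?_ (hΓ.insert hφ)), h₂⟩
  · exact Set.insert_subset_insert (Set.subset_insert _ _)
  · rintro χ (rfl | rfl | hχ) <;> simp [*]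

/-- A separating formula can be chosen without superfluous free variables. -/
theorem exists_freeVars_subset (h : Separable Γ Δ) : ∃ θ : PreFormula L 0, θ.IsFormula ∧
    Inconsistent (insert (θ.expand k).neg Γ) ∧ Inconsistent (insert (θ.expand k) Δ) ∧
    ∀ x ∈ θ.freeVars, (∃ φ ∈ Γ, x ∈ φ.freeVars) ∨ ∃ φ ∈ Δ, x ∈ φ.freeVars := by
  obtain ⟨θ, hθ, h₁, h₂⟩ := h
  let X : Set Var.{u} :=
    {x ∈ θ.freeVars | ¬ ((∃ φ ∈ Γ, x ∈ φ.freeVars) ∨ ∃ φ ∈ Δ, x ∈ φ.freeVars)}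
  have hX : X.Finite := Set.Finite.subset hθ fun x hx => hx.1
  obtain ⟨n, w, hw, hwr⟩ := hX.fin_param
  have hwX : ∀ i, w i ∈ X := fun i => hwr ▸ Set.mem_range_self i
  have hf := (hθ.bind w).expand k
  -- The superfluous variables `w` are quantified universally. They are not free in `Γ`, so `Γ`
  -- still proves the result; instantiating them by themselves shows that `Δ` still refutes it.
  refine ⟨.all _ (θ.bind w), hθ.bind w, ?_, ?_, ?_⟩
  · refine Inconsistent.neg_all hf hw ?_ ?_ ?_
    · intro i hi
      rw [PreFormula.freeVars_expand] at hi
      exact (PreFormula.mem_freeVars_bind hi).2 i rfl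
    · exact fun i ψ hψ hi => (hwX i).2 (Or.inl ⟨ψ, hψ, hi⟩)
    · rwa [PreFormula.expand_bind_inst]
  · exact Inconsistent.all hf (fun i => .fvar (w i)) (by rwa [PreFormula.expand_bind_inst])
  · intro x hx
    obtain ⟨hx, hx'⟩ := PreFormula.mem_freeVars_bind hx
    by_contra hc
    obtain ⟨i, hi⟩ : x ∈ Set.range w := hwr ▸ ⟨hx, hc⟩
    exact hx' i hi

/-- The separator is the disjunction `¬⋀ ¬θ i` of separators `θ i` for the `¬ f i`. It is a formula
only if the `θ i` share a finite set of free variables, whence the two finiteness hypotheses and the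
use of `exists_freeVars_subset`. -/
theorem neg_conj {ι : Type u} {f : ι → PreFormula (L.adjoin k) 0}
    (hf : (PreFormula.conj f).IsFormula) (hΓ : IsContext Γ) (hΔ : IsContext Δ)
    (hΓ' : (⋃ φ ∈ Γ, φ.freeVars).Finite) (hΔ' : (⋃ φ ∈ Δ, φ.freeVars).Finite)
    (h : ∀ i, Separable (insert (f i).neg Γ) Δ) :
    Separable (insert (PreFormula.conj f).neg Γ) Δ := by
  choose θ hθ h₁ h₂ hx using fun i => (h i).exists_freeVars_subset
  have hc : (PreFormula.conj fun i => (θ i).neg).IsFormula := by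
    refine Set.Finite.subset ((hΓ'.union hΔ').union hf) fun x hx' => ?_
    obtain ⟨i, hi⟩ := Set.mem_iUnion.1 hx'
    rcases hx i x hi with ⟨φ, rfl | hφ, h⟩ | ⟨φ, hφ, h⟩
    · exact Or.inr (Set.mem_iUnion.2 ⟨i, h⟩)
    · exact Or.inl (Or.inl (Set.mem_iUnion₂.2 ⟨φ, hφ, h⟩))
    · exact Or.inl (Or.inr (Set.mem_iUnion₂.2 ⟨φ, hφ, h⟩))
  have hc' : (PreFormula.conj fun i => ((θ i).expand k).neg).IsFormula := hc.expand k
  refine ⟨(PreFormula.conj fun i => (θ i).neg).neg, hc, ?_, ?_⟩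
  · refine Inconsistent.neg_neg ?_
    rw [Set.insert_comm]
    refine Inconsistent.neg_conj hf (hΓ.insert hc') fun i => ?_
    rw [Set.insert_comm]
    have hΓi := hΓ.insert (φ := (f i).neg) (hf.of_conj i)
    refine Inconsistent.conj hc' hΓi ((h₁ i).mono ?_ (hΓi.union ⟨?_, ?_⟩))
    · exact Set.insert_subset (Or.inr ⟨i, rfl⟩) Set.subset_union_left
    · infer_instance
    · rintro _ ⟨j, rfl⟩
      exact (hθ j).expand k
  · exact Inconsistent.neg_conj hc' hΔ fun i => (h₂ i).neg_neg

/-- The rule for negated conjunctions, applied to `φ ∧ ¬φ`, gives a separator in the presence of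
`¬(φ ∧ ¬φ)`. This last formula is provable and is cut away. -/
theorem cut (hΓ' : (⋃ φ ∈ Γ, φ.freeVars).Finite) (hΔ' : (⋃ φ ∈ Δ, φ.freeVars).Finite)
    (h : Separable (insert φ Γ) Δ) (h' : Separable (insert φ.neg Γ) Δ) : Separable Γ Δ := by
  have hφ := h.context_left.isFormula φ (by simp)
  have hΓ := h.context_left.of_insert
  have hφ' : φ.neg.IsFormula := hφ
  have h₁ : Separable (insert φ.neg.neg Γ) Δ := by
    obtain ⟨θ, hθ, h₁, h₂⟩ := h
    rw [Set.insert_comm] at h₁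
    exact ⟨θ, hθ, by rw [Set.insert_comm]; exact h₁.neg_neg, h₂⟩
  have h₂ : Separable (insert (φ.and φ.neg).neg Γ) Δ := by
    refine neg_conj (hφ.and hφ') hΓ h.context_right hΓ' hΔ' fun b => ?_
    rcases b with ⟨_ | _⟩
    exacts [h₁, h']
  obtain ⟨θ, hθ, h₁, h₂⟩ := h₂
  refine ⟨θ, hθ, .cut (φ := φ.and φ.neg) (Inconsistent.and ?_) (by rwa [Set.insert_comm]), h₂⟩
  exact .of_mem (((hΓ.insert (φ := (θ.expand k).neg) (hθ.expand k)).insert hφ').insert hφ) (φ := φ) (by simp) (by simp)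

/-- The separator is `∃ w θ`, written `¬∀ w ¬θ`. Here `w` must be fresh for `Δ` as well, since `Δ`
has to refute the existential formula. -/
theorem neg_all {χ : PreFormula (L.adjoin k) n} (hχ : χ.IsFormula) {w : Fin n → Var.{u}}
    (hw : Function.Injective w) (hwχ : ∀ i, w i ∉ χ.freeVars)
    (hwΓ : ∀ i, ∀ ψ ∈ Γ, w i ∉ ψ.freeVars) (hwΔ : ∀ i, ∀ ψ ∈ Δ, w i ∉ ψ.freeVars)
    (h : Separable (insert (χ.inst fun i => .fvar (w i)).neg Γ) Δ) :
    Separable (insert (PreFormula.all n χ).neg Γ) Δ := by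
  obtain ⟨θ, hθ, h₁, h₂⟩ := h
  have hθ' : θ.neg.IsFormula := hθ
  have hf := (PreFormula.IsFormula.bind hθ' w).expand k
  have hb : (PreFormula.all (n := 0) n (θ.neg.bind w)).neg.IsFormula := PreFormula.IsFormula.bind hθ' w
  have hwθ : ∀ i, w i ∉ ((θ.neg.bind w).expand k).freeVars := by
    intro i hi
    rw [PreFormula.freeVars_expand] at hi
    exact (PreFormula.mem_freeVars_bind hi).2 i rfl
  refine ⟨(PreFormula.all (n := 0) n (θ.neg.bind w)).neg, hb, Inconsistent.neg_neg ?_, ?_⟩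
  · rw [Set.insert_comm]
    refine Inconsistent.neg_all hχ hw hwχ ?_ ?_
    · rintro i ψ (rfl | hψ)
      exacts [hwθ i, hwΓ i ψ hψ]
    · rw [Set.insert_comm]
      refine Inconsistent.all hf (fun i => .fvar (w i)) ?_
      rwa [PreFormula.expand_bind_inst]
  · refine Inconsistent.neg_all hf hw hwθ hwΔ ?_
    rw [PreFormula.expand_bind_inst]
    exact h₂.neg_neg

/-- Formulae of the smaller signature can be moved from one side to the other. -/
theorem insert_expand_neg (α : PreFormula L 0) (h : Separable (insert (α.expand k).neg Γ) Δ) :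
    Separable Γ (insert (α.expand k).neg Δ) := by
  obtain ⟨θ, hθ, h₁, h₂⟩ := h
  have hα' := h₁.isContext.isFormula (α.expand k).neg (by simp)
  have hα : α.neg.IsFormula := by
    have := hα'
    unfold PreFormula.IsFormula at this ⊢
    rwa [← PreFormula.freeVars_expand _ k]
  have hθ' : θ.neg.IsFormula := hθ
  -- The new separator is `α ∨ θ`: it follows from `Γ` because `Γ, ¬α ⊢ θ`, and it is refuted by `Δ,
  -- ¬α` because `Δ` refutes `θ`.
  refine ⟨(α.neg.and θ.neg).neg, hα.and hθ', ?_, ?_⟩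
  · refine Inconsistent.neg_neg ?_
    rw [PreFormula.expand_and]
    exact Inconsistent.and (by rw [Set.insert_comm]; exact h₁)
  · show Inconsistent (insert ((α.neg.and θ.neg).expand k).neg _)
    rw [PreFormula.expand_and]
    have hΔ := h₂.isContext.of_insert.insert hα'
    refine Inconsistent.neg_and (.of_mem (hΔ.insert hα') (φ := (α.expand k).neg) ?_ ?_) ?_
    · simp
    · exact Set.mem_insert _ _
    · exact (h₂.mono (Set.insert_subset_insert (Set.subset_insert _ _))
        (hΔ.insert (hθ.expand k))).neg_neg

end Separable

/-- If `R(x)` and `¬ R(x)` can be separated by an `L`-formula, then `R` is explicitly definable. -/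
theorem ExplicitlyBooleanDefinable.of_separable {T : Set (PreFormula (L.adjoin k) 0)}
    (hT : ∀ φ ∈ T, φ.IsSentence) {w : Fin k → Var.{u}} (hw : Function.Injective w)
    (h : Separable (insert (.rel (L := L.adjoin k) none fun i => .fvar (w i)) T)
      (insert (PreFormula.rel (L := L.adjoin k) none fun i => .fvar (w i)).neg T)) :
    ExplicitlyBooleanDefinable T := by
  obtain ⟨θ, hθ, h₁, h₂, hx⟩ := h.exists_freeVars_subset
  have hTx : ∀ x : Var.{u}, ∀ φ ∈ T, x ∉ φ.freeVars := by
    intro x φ hφ hx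
    rw [show φ.freeVars = ∅ from hT φ hφ] at hx
    exact hx
  have hR : ∀ x, x ∈ (PreFormula.rel (L := L.adjoin k) (n := 0) none
      fun i : Fin k => .fvar (w i)).freeVars → ∃ i, w i = x := by
    intro x hx
    obtain ⟨i, hi⟩ := Set.mem_iUnion.1 hx
    exact ⟨i, (Set.mem_singleton_iff.1 hi).symm⟩
  have hs : (θ.bind w).IsSentence := by
    refine Set.eq_empty_iff_forall_notMem.2 fun x hxθ => ?_
    obtain ⟨hxθ, hxw⟩ := PreFormula.mem_freeVars_bind hxθ
    rcases hx x hxθ with ⟨φ, rfl | hφ, hxφ⟩ | ⟨φ, rfl | hφ, hxφ⟩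
    · obtain ⟨i, hi⟩ := hR x hxφ; exact hxw i hi
    · exact hTx x φ hφ hxφ
    · obtain ⟨i, hi⟩ := hR x hxφ; exact hxw i hi
    · exact hTx x φ hφ hxφ
  refine ⟨θ.bind w, hs, Inconsistent.derivable_of_neg ?_⟩
  have hrel : (PreFormula.rel (L := L.adjoin k) (n := k) none fun i => .bvar i).IsFormula :=
    Set.finite_iUnion fun i => Set.finite_empty
  have he := hs.isFormula.expand k
  -- The quantifier is removed with `w` itself as eigenvariables: `T` and the defining sentence have
  -- no free variables. The two implications that remain are the two halves of separation.
  have himp : ∀ {φ ψ : PreFormula (L.adjoin k) k}, φ.IsFormula → ψ.IsFormula →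
      (φ.imp ψ).IsFormula := fun h h' => PreFormula.IsFormula.and (ψ := PreFormula.neg _) h h'
  refine Inconsistent.neg_all (PreFormula.IsFormula.and (himp hrel he) (himp he hrel)) hw ?_
    (fun i => hTx _) ?_
  · intro i hi
    have h0 : ∀ x, x ∉ ((θ.bind w).expand k).freeVars := by
      intro x hx
      rw [PreFormula.freeVars_expand, show (θ.bind w).freeVars = ∅ from hs] at hx
      exact hx
    have h1 : ∀ x, x ∉ (PreFormula.rel (L := L.adjoin k) (n := k) none
        fun i => .bvar i).freeVars := by
      intro x hx
      obtain ⟨i, hi⟩ := Set.mem_iUnion.1 hx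
      exact hi
    simp only [PreFormula.iff, PreFormula.imp, PreFormula.freeVars_and,
      PreFormula.freeVars] at hi
    rcases hi with (hi | hi) | (hi | hi)
    exacts [h1 _ hi, h0 _ hi, h0 _ hi, h1 _ hi]
  · have hinst : ∀ φ ψ : PreFormula (L.adjoin k) k, ∀ t : Fin k → Term (L.adjoin k) 0,
        (φ.iff ψ).inst t = (φ.inst t).iff (ψ.inst t) := by
      intro φ ψ t
      simp only [PreFormula.inst, PreFormula.iff, PreFormula.imp, PreFormula.subst_and,
        PreFormula.subst]
    rw [hinst, PreFormula.expand_bind_inst]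
    refine Inconsistent.neg_and (Inconsistent.neg_neg (Inconsistent.and ?_))
      (Inconsistent.neg_neg (Inconsistent.and ?_))
    · rw [Set.insert_comm]
      exact h₁
    · exact h₂

end InfLogic

namespace InfLogic

/-! ### The complete Boolean algebra of regular elements -/

theorem isRegular_sInf {α : Type*} [Order.Frame α] {S : Set α}
    (h : ∀ a ∈ S, Heyting.IsRegular a) : Heyting.IsRegular (sInf S) := by
  refine le_antisymm (le_sInf fun a ha => ?_) le_compl_compl
  rw [← (h a ha).eq]
  exact compl_le_compl (compl_le_compl (sInf_le ha))

/-- Regular elements are closed under infima of the frame, while suprema have to be regularized.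
Conjunctions and quantifiers are thus evaluated by plain intersections. -/
noncomputable instance regularCompleteBooleanAlgebra {α : Type*} [Order.Frame α] :
    CompleteBooleanAlgebra (Heyting.Regular α) where
  __ := (inferInstance : BooleanAlgebra (Heyting.Regular α))
  sInf S := ⟨sInf (Heyting.Regular.val '' S), isRegular_sInf (by
    rintro _ ⟨a, -, rfl⟩
    exact a.prop)⟩
  sSup S := Heyting.Regular.toRegular (sSup (Heyting.Regular.val '' S))
  isLUB_sSup S := ⟨fun a ha => (le_sSup (Set.mem_image_of_mem _ ha)).trans le_compl_compl,
    fun b hb => (Heyting.Regular.gi.gc _ _).2 (sSup_le (by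
      rintro _ ⟨a, ha, rfl⟩
      exact hb ha))⟩
  isGLB_sInf S := ⟨fun a ha => sInf_le (Set.mem_image_of_mem _ ha),
    fun b hb => le_sInf (by
      rintro _ ⟨a, ha, rfl⟩
      exact hb ha)⟩

theorem coe_iInf_regular {α : Type*} [Order.Frame α] {ι : Sort*} (f : ι → Heyting.Regular α) :
    (⨅ i, f i).val = ⨅ i, (f i).val := by
  show sInf (Heyting.Regular.val '' Set.range f) = _
  rw [← Set.range_comp]
  rfl

/-- The forcing clause for negation. -/
theorem mem_compl_lowerSet {Q : Type*} [Preorder Q] {S : LowerSet Q} {p : Q} :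
    p ∈ Sᶜ ↔ ∀ q ≤ p, q ∉ S := by
  rw [← LowerSet.Iic_le, le_compl_iff_disjoint_right, disjoint_iff_inf_le]
  exact ⟨fun h q hq hS => h ⟨hq, hS⟩, fun h q hq => h q hq.1 hq.2⟩

variable {L : Signature.{u}} {k n m : ℕ}

/-! ### Pairs of sets of formulae -/

/-- `T` is a set-sized collection of sentences. -/
class IsTheory (T : Set (PreFormula L 0)) : Prop where
  small : Small.{u} T
  isSentence : ∀ φ ∈ T, φ.IsSentence

theorem IsTheory.isContext (T : Set (PreFormula L 0)) [IsTheory T] : IsContext T :=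
  ⟨small, fun φ hφ => (isSentence φ hφ).isFormula⟩

theorem IsTheory.notMem_freeVars {T : Set (PreFormula L 0)} [IsTheory T] {φ : PreFormula L 0}
    (hφ : φ ∈ T) (x : Var.{u}) : x ∉ φ.freeVars := by
  rw [show φ.freeVars = ∅ from isSentence φ hφ]
  exact Set.notMem_empty x

/-- Pairs of sets of formulae, one for each of two models to be built. -/
abbrev FormulaPair (L : Signature.{u}) : Type (u + 1) := Bool → Set (PreFormula L 0)

/-- Add a formula on the side `b`. -/
def FormulaPair.add (b : Bool) (φ : PreFormula L 0) (p : FormulaPair L) : FormulaPair L :=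
  Function.update p b (insert φ (p b))

/-- Both sides are finite sets of formulae. -/
def FormulaPair.IsFinite (p : FormulaPair L) : Prop :=
  ∀ b, (p b).Finite ∧ ∀ φ ∈ p b, φ.IsFormula

theorem FormulaPair.add_same (b : Bool) (φ : PreFormula L 0) (p : FormulaPair L) :
    p.add b φ b = insert φ (p b) := Function.update_self ..

theorem FormulaPair.add_not (b : Bool) (φ : PreFormula L 0) (p : FormulaPair L) :
    p.add b φ (!b) = p (!b) := Function.update_of_ne (by simp) ..

theorem FormulaPair.subset_add (b : Bool) (φ : PreFormula L 0) (p : FormulaPair L) :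
    p ≤ p.add b φ := by
  intro c
  by_cases h : c = b
  · subst h; rw [add_same]; exact Set.subset_insert _ _
  · rw [add, Function.update_of_ne h]

theorem FormulaPair.add_mono (b : Bool) (φ : PreFormula L 0) {p q : FormulaPair L} (h : p ≤ q) :
    p.add b φ ≤ q.add b φ := by
  intro c
  by_cases hc : c = b
  · subst hc; rw [add_same, add_same]; exact Set.insert_subset_insert (h c)
  · rw [add, add, Function.update_of_ne hc, Function.update_of_ne hc]; exact h c

theorem FormulaPair.add_eq_self {b : Bool} {φ : PreFormula L 0} {p : FormulaPair L}
    (h : φ ∈ p b) : p.add b φ = p := by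
  rw [add, Set.insert_eq_of_mem h, Function.update_eq_self]

theorem FormulaPair.mem_add {b c : Bool} {φ ψ : PreFormula L 0} {p : FormulaPair L}
    (h : ψ ∈ p.add b φ c) : ψ = φ ∨ ψ ∈ p c := by
  by_cases hc : c = b
  · subst hc; rw [add_same] at h; exact h
  · rw [add, Function.update_of_ne hc] at h; exact Or.inr h

theorem FormulaPair.finite_add {b : Bool} {φ : PreFormula L 0} {p : FormulaPair L}
    (hp : ∀ c, (p c).Finite) (c : Bool) : (p.add b φ c).Finite :=
  ((hp c).insert φ).subset fun _ h => mem_add h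

theorem FormulaPair.IsFinite.add {p : FormulaPair L} (h : p.IsFinite) (b : Bool)
    {φ : PreFormula L 0} (hφ : φ.IsFormula) : (p.add b φ).IsFinite := fun c =>
  ⟨FormulaPair.finite_add (fun c => (h c).1) c, fun ψ hψ => by
    rcases FormulaPair.mem_add hψ with rfl | hψ
    exacts [hφ, (h c).2 ψ hψ]⟩

variable (T : Set (PreFormula (L.adjoin k) 0))

/-- The two sides are separated over `T` by an `L`-formula. -/
def FormulaPair.IsSeparable (p : FormulaPair (L.adjoin k)) : Prop :=
  Separable (T ∪ p true) (T ∪ p false)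

/-- `p` forces `φ` in the model with index `b`. -/
def FormulaPair.Forces (b : Bool) (φ : PreFormula (L.adjoin k) 0)
    (p : FormulaPair (L.adjoin k)) : Prop :=
  (p.add b φ.neg).IsSeparable T

variable {T}

namespace FormulaPair

variable {p q : FormulaPair (L.adjoin k)} {φ ψ : PreFormula (L.adjoin k) 0} {b : Bool}

theorem isSeparable_iff (b : Bool) : p.IsSeparable T ↔ Separable (T ∪ p b) (T ∪ p (!b)) := by
  cases b
  · exact ⟨Separable.symm, Separable.symm⟩
  · exact Iff.rfl

theorem isSeparable_add_iff : (p.add b φ).IsSeparable T ↔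
    Separable (insert φ (T ∪ p b)) (T ∪ p (!b)) := by
  rw [isSeparable_iff b, add_same, add_not, Set.union_insert]

/-- This is what makes the two models agree on `L`: a negated `L`-formula added on one side can be
moved to the other without loss of separability. -/
theorem forces_expand_iff (α : PreFormula L 0) :
    p.Forces T true (α.expand k) ↔ p.Forces T false (α.expand k) := by
  have key : ∀ b, p.Forces T b (α.expand k) → p.Forces T (!b) (α.expand k) := by
    intro b h
    have := (isSeparable_add_iff.1 h).insert_expand_neg α
    refine isSeparable_add_iff.2 ?_
    rw [Bool.not_not]
    exact this.symm
  exact ⟨key true, key false⟩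

variable [IsTheory T]

theorem IsFinite.isContext (hp : p.IsFinite) (b : Bool) : IsContext (T ∪ p b) :=
  (IsTheory.isContext T).union (.of_finite (hp b).1 (hp b).2)

theorem IsFinite.finite_freeVars (hp : p.IsFinite) (b : Bool) :
    (⋃ φ ∈ T ∪ p b, φ.freeVars).Finite := by
  refine ((hp b).1.biUnion fun φ hφ => (hp b).2 φ hφ).subset fun x hx => ?_
  obtain ⟨φ, hφ | hφ, hx⟩ := Set.mem_iUnion₂.1 hx
  · exact (IsTheory.notMem_freeVars hφ x hx).elim
  · exact Set.mem_iUnion₂.2 ⟨φ, hφ, hx⟩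

theorem IsSeparable.mono (h : p.IsSeparable T) (hpq : p ≤ q) (hq : q.IsFinite) :
    q.IsSeparable T :=
  Separable.mono h (Set.union_subset_union_right _ (hpq true))
    (Set.union_subset_union_right _ (hpq false)) (hq.isContext true) (hq.isContext false)

theorem IsSeparable.cut (hp : p.IsFinite) (h : (p.add b φ).IsSeparable T) (h' : p.Forces T b φ) :
    p.IsSeparable T := by
  rw [isSeparable_iff b]
  exact Separable.cut (hp.finite_freeVars b) (hp.finite_freeVars _)
    (isSeparable_add_iff.1 h) (isSeparable_add_iff.1 h')

theorem Forces.mono (h : p.Forces T b φ) (hpq : p ≤ q) (hq : q.IsFinite) (hφ : φ.IsFormula) :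
    q.Forces T b φ :=
  IsSeparable.mono h (add_mono b _ hpq) (hq.add b hφ)

theorem Forces.of_inconsistent (hp : p.IsFinite) (h : Inconsistent (insert φ (insert ψ.neg T)))
    (h' : p.Forces T b φ) : p.Forces T b ψ := by
  refine isSeparable_add_iff.2 ((isSeparable_add_iff.1 h').of_inconsistent_insert (h.mono ?_ ?_))
  · exact Set.insert_subset_insert (Set.insert_subset_insert Set.subset_union_left)
  · exact ((hp.isContext b).insert (h.isContext.isFormula _ (by simp))).insert
      (h.isContext.isFormula _ (by simp))

theorem forces_of_inconsistent (hp : p.IsFinite) (h : Inconsistent (insert ψ.neg T)) :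
    p.Forces T b ψ :=
  isSeparable_add_iff.2 (.of_inconsistent (h.mono (Set.insert_subset_insert Set.subset_union_left)
    ((hp.isContext b).insert (h.isContext.isFormula _ (by simp)))) (hp.isContext _))

/-- Downwards this is closure under consequences, upwards the disjunction of separators. The latter
applies because a finite pair over a set of sentences has finitely many free variables. -/
theorem forces_conj_iff (hp : p.IsFinite) {ι : Type u} {f : ι → PreFormula (L.adjoin k) 0}
    (hf : (PreFormula.conj f).IsFormula) :
    p.Forces T b (.conj f) ↔ ∀ i, p.Forces T b (f i) := by
  refine ⟨fun h i => h.of_inconsistent hp ?_, fun h => ?_⟩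
  · have hT := (IsTheory.isContext T).insert (φ := (f i).neg) (hf.of_conj i)
    have hc : IsContext (insert (f i).neg T ∪ Set.range f) := hT.union ⟨inferInstance, by
      rintro _ ⟨j, rfl⟩
      exact hf.of_conj j⟩
    exact Inconsistent.conj hf hT (.of_mem hc (φ := f i) (by simp) (by simp))
  · refine isSeparable_add_iff.2 (Separable.neg_conj hf (hp.isContext b) (hp.isContext _)
      (hp.finite_freeVars b) (hp.finite_freeVars _) fun i => isSeparable_add_iff.1 (h i))

/-- Forced formulae are closed under derivations from finitely many premises. -/
theorem forces_of_derivable (hp : p.IsFinite) {Φ : Set (PreFormula (L.adjoin k) 0)}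
    (hΦ : Φ.Finite) (hf : ∀ φ ∈ Φ, φ.IsFormula) (hψ : ψ.IsFormula) (h : Derivable Φ {ψ})
    (h' : ∀ φ ∈ Φ, p.Forces T b φ) : p.Forces T b ψ := by
  have hc := IsContext.of_finite hΦ hf
  have := hc.small
  -- The premises are reindexed by a type in `Type u`, so that their conjunction is a pre-formula.
  let f : Shrink.{u} Φ → PreFormula (L.adjoin k) 0 := fun i => ((equivShrink Φ).symm i : Φ)
  have hfΦ : Set.range f = Φ := by
    have : f = Subtype.val ∘ (equivShrink Φ).symm := rfl
    rw [this, Set.range_comp, Equiv.range_eq_univ, Set.image_univ, Subtype.range_coe]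
  have hconj : (PreFormula.conj f).IsFormula := by
    refine (hΦ.biUnion fun φ hφ => hf φ hφ).subset fun x hx => ?_
    obtain ⟨i, hi⟩ := Set.mem_iUnion.1 hx
    exact Set.mem_iUnion₂.2 ⟨f i, hfΦ ▸ ⟨i, rfl⟩, hi⟩
  have hT := (IsTheory.isContext T).insert (φ := ψ.neg) hψ
  refine ((forces_conj_iff hp hconj).2 fun i => h' _ (hfΦ ▸ ⟨i, rfl⟩)).of_inconsistent hp
    (Inconsistent.conj hconj hT ?_)
  rw [hfΦ]
  refine (Inconsistent.of_derivable hc hψ h).mono ?_ (hT.union hc)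
  exact Set.insert_subset (Or.inl (by simp)) Set.subset_union_right

end FormulaPair

/-! ### The domain and the fragment -/

/-- Countably many variables and all constants. -/
abbrev TermDomain (L : Signature.{u}) : Type u := ULift.{u} ℕ ⊕ L.Const

def TermDomain.toTerm : TermDomain L → Term L n
  | .inl i => .fvar (i.down : Ordinal.{u})
  | .inr c => .const c

theorem TermDomain.toTerm_lift (t : TermDomain L) (j : ℕ) :
    (t.toTerm : Term L n).lift j = t.toTerm := by
  cases t <;> rfl

theorem TermDomain.toTerm_subst (t : TermDomain L) (β : Fin n → Term L m) :
    (t.toTerm : Term L n).subst β .fvar = t.toTerm := by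
  cases t <;> rfl

/-- The immediate subformulae, where quantified variables are replaced by elements of the
domain. -/
def PreFormula.components : PreFormula L 0 → Set (PreFormula L 0)
  | .eq _ _ => ∅
  | .rel _ _ => ∅
  | .neg φ => {φ}
  | .conj f => Set.range f
  | .all k φ => Set.range fun t : Fin k → TermDomain L => φ.inst fun i => (t i).toTerm

theorem PreFormula.small_components (φ : PreFormula L 0) : Small.{u} φ.components := by
  cases φ <;> unfold components <;> infer_instance

theorem PreFormula.IsFormula.components {φ : PreFormula L 0} (h : φ.IsFormula) :
    ∀ ψ ∈ φ.components, ψ.IsFormula := by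
  intro ψ hψ
  cases φ with
  | eq => exact hψ.elim
  | rel => exact hψ.elim
  | neg φ => obtain rfl := hψ; exact h
  | conj f => obtain ⟨i, rfl⟩ := hψ; exact h.of_conj i
  | all k φ => obtain ⟨t, rfl⟩ := hψ; exact IsFormula.inst (φ := φ) h _

/-- The atomic formulae over the domain enter at the start because their values are to define the
models. Negations are added at each stage because conditions decide `φ` by containing `¬φ`. -/
def fragmentStage (T : Set (PreFormula L 0)) : ℕ → Set (PreFormula L 0)
  | 0 => T ∪ (Set.range (fun t : TermDomain L × TermDomain L => .eq t.1.toTerm t.2.toTerm) ∪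
      Set.range (fun t : Σ R : L.Rel, Fin (L.arity R) → TermDomain L =>
        .rel t.1 fun i => (t.2 i).toTerm))
  | n + 1 => fragmentStage T n ∪ ⋃ φ ∈ fragmentStage T n, insert φ.neg φ.components

/-- The closure of `T` and the atomic formulae under negations and components. -/
def fragment (T : Set (PreFormula L 0)) : Set (PreFormula L 0) := ⋃ n, fragmentStage T n

theorem small_fragment (T : Set (PreFormula L 0)) [Small.{u} T] : Small.{u} (fragment T) := by
  have : ∀ n, Small.{u} (fragmentStage T n) := by
    intro n
    induction n with
    | zero => unfold fragmentStage; infer_instance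
    | succ n ih =>
      unfold fragmentStage
      have (φ : PreFormula L 0) := φ.small_components
      infer_instance
  unfold fragment
  infer_instance

theorem isFormula_of_mem_fragment {T : Set (PreFormula L 0)} (hT : ∀ φ ∈ T, φ.IsFormula)
    {φ : PreFormula L 0} (h : φ ∈ fragment T) : φ.IsFormula := by
  obtain ⟨n, hn⟩ := Set.mem_iUnion.1 h
  clear h
  induction n generalizing φ with
  | zero =>
    rcases hn with h | ⟨t, rfl⟩ | ⟨t, rfl⟩
    · exact hT φ h
    · exact (Term.finite_freeVars _).union (Term.finite_freeVars _)
    · exact Set.finite_iUnion fun i => Term.finite_freeVars _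
  | succ n ih =>
    rcases hn with h | h
    · exact ih h
    · obtain ⟨ψ, hψ, h⟩ := Set.mem_iUnion₂.1 h
      rcases h with rfl | h
      · exact ih (φ := ψ) hψ
      · exact (ih hψ).components φ h

theorem subset_fragment (T : Set (PreFormula L 0)) : T ⊆ fragment T :=
  fun _ h => Set.mem_iUnion.2 ⟨0, Or.inl h⟩

theorem eq_mem_fragment (T : Set (PreFormula L 0)) (s t : TermDomain L) :
    .eq s.toTerm t.toTerm ∈ fragment T :=
  Set.mem_iUnion.2 ⟨0, Or.inr (Or.inl ⟨(s, t), rfl⟩)⟩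

theorem rel_mem_fragment (T : Set (PreFormula L 0)) (R : L.Rel)
    (t : Fin (L.arity R) → TermDomain L) :
    (PreFormula.rel R fun i => (t i).toTerm) ∈ fragment T :=
  Set.mem_iUnion.2 ⟨0, Or.inr (Or.inr ⟨⟨R, t⟩, rfl⟩)⟩

theorem neg_mem_fragment {T : Set (PreFormula L 0)} {φ : PreFormula L 0} (h : φ ∈ fragment T) :
    φ.neg ∈ fragment T := by
  obtain ⟨n, h⟩ := Set.mem_iUnion.1 h
  exact Set.mem_iUnion.2 ⟨n + 1, Or.inr (Set.mem_iUnion₂.2 ⟨φ, h, Set.mem_insert _ _⟩)⟩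

theorem components_subset_fragment {T : Set (PreFormula L 0)} {φ : PreFormula L 0}
    (h : φ ∈ fragment T) : φ.components ⊆ fragment T := by
  intro ψ hψ
  obtain ⟨n, h⟩ := Set.mem_iUnion.1 h
  exact Set.mem_iUnion.2 ⟨n + 1, Or.inr (Set.mem_iUnion₂.2 ⟨φ, h, Set.mem_insert_of_mem _ hψ⟩)⟩

theorem exists_fresh {X : Set Var.{u}} (hX : X.Finite) (n : ℕ) :
    ∃ w : Fin n → ULift.{u} ℕ, Function.Injective (fun i => ((w i).down : Ordinal.{u})) ∧
      ∀ i, ((w i).down : Ordinal.{u}) ∉ X := by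
  have hf : ((Nat.cast : ℕ → Ordinal.{u}) ⁻¹' X).Finite := hX.preimage Nat.cast_injective.injOn
  obtain ⟨N, hN⟩ := hf.bddAbove
  -- `N` bounds the natural numbers whose variable lies in `X`.
  refine ⟨fun i => ⟨N + 1 + i⟩, fun i j h => ?_, fun i hi => ?_⟩
  · have := Nat.cast_injective h
    exact Fin.ext (by simpa using this)
  · have : N + 1 + (i : ℕ) ≤ N := hN hi
    omega

/-- For the converse it is enough to use one instance, at variables of the domain that are fresh for
both sides and for `χ`. Infinitely many variables in the domain guarantee that they exist. -/
theorem FormulaPair.forces_all_iff {T : Set (PreFormula (L.adjoin k) 0)} [IsTheory T]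
    {p : FormulaPair (L.adjoin k)} {b : Bool} (hp : p.IsFinite)
    {χ : PreFormula (L.adjoin k) n} (hχ : χ.IsFormula) :
    p.Forces T b (.all n χ) ↔
      ∀ t : Fin n → TermDomain (L.adjoin k), p.Forces T b (χ.inst fun i => (t i).toTerm) := by
  refine ⟨fun h t => h.of_inconsistent hp ?_, fun h => ?_⟩
  · refine Inconsistent.all hχ (fun i => (t i).toTerm)
      (.of_mem (((IsTheory.isContext T).insert ?_).insert (hχ.inst _)) (Set.mem_insert _ _) ?_)
    · exact hχ.inst _
    · simp
  · obtain ⟨w, hw, hwX⟩ := exists_fresh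
      ((Set.Finite.union (hp.finite_freeVars (T := T) b) (hp.finite_freeVars (T := T) !b)).union hχ)
      n
    refine isSeparable_add_iff.2 (Separable.neg_all hχ hw (fun i hi => hwX i (Or.inr hi))
      (fun i ψ hψ hi => hwX i (Or.inl (Or.inl (Set.mem_iUnion₂.2 ⟨ψ, hψ, hi⟩))))
      (fun i ψ hψ hi => hwX i (Or.inl (Or.inr (Set.mem_iUnion₂.2 ⟨ψ, hψ, hi⟩)))) ?_)
    exact isSeparable_add_iff.1 (h fun i => .inl (w i))

end InfLogic

namespace InfLogic

variable {L : Signature.{u}} {k n m : ℕ} {T : Set (PreFormula (L.adjoin k) 0)}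

/-! ### The forcing conditions -/

variable (T) in
/-- The finite pairs from the fragment that cannot be separated. -/
def conditions : Set (FormulaPair (L.adjoin k)) :=
  {p | (∀ b, (p b).Finite ∧ p b ⊆ fragment T) ∧ ¬ p.IsSeparable T}

/-- Conditions embed into pairs of subsets of the small fragment. Smallness puts the algebra into
`Type u`, over which implicit definability quantifies. -/
instance [IsTheory T] : Small.{u} (conditions T) := by
  have := IsTheory.small (T := T)
  have := small_fragment T
  refine small_of_injective (β := Bool → Set (fragment T))
    (f := fun p b => Subtype.val ⁻¹' (p.1 b)) fun p q h => Subtype.ext (funext fun b => ?_)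
  have h := congrFun h b
  rw [Set.preimage_eq_preimage'] at h
  · exact h
  · rw [Subtype.range_coe]; exact (p.2.1 b).2
  · rw [Subtype.range_coe]; exact (q.2.1 b).2

variable (T) in
/-- A small copy of the conditions. -/
def Condition [IsTheory T] : Type u := Shrink.{u} (conditions T)

namespace Condition

variable [IsTheory T] {b : Bool} {φ : PreFormula (L.adjoin k) 0}

/-- The underlying pair of sets. -/
noncomputable def pair (p : Condition T) : FormulaPair (L.adjoin k) :=
  ((equivShrink (conditions T)).symm p : conditions T)

theorem pair_mem (p : Condition T) : p.pair ∈ conditions T :=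
  ((equivShrink (conditions T)).symm p).2

theorem exists_pair_eq {p : FormulaPair (L.adjoin k)} (h : p ∈ conditions T) :
    ∃ q : Condition T, q.pair = p :=
  ⟨equivShrink _ ⟨p, h⟩, by simp [pair]⟩

theorem isFinite (p : Condition T) : p.pair.IsFinite := fun b =>
  ⟨(p.pair_mem.1 b).1, fun _ hφ => isFormula_of_mem_fragment
    (IsTheory.isContext T).isFormula ((p.pair_mem.1 b).2 hφ)⟩

noncomputable instance : Preorder (Condition T) where
  le p q := q.pair ≤ p.pair
  le_refl _ := le_rfl
  le_trans _ _ _ h h' := le_trans h' h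

/-- The enlarged pair is itself a condition. -/
theorem exists_of_not_isSeparable (p : Condition T) (hφ : φ ∈ fragment T)
    (h : ¬ (p.pair.add b φ).IsSeparable T) : ∃ q ≤ p, φ ∈ q.pair b := by
  obtain ⟨q, hq⟩ := exists_pair_eq (T := T) (p := p.pair.add b φ)
    ⟨fun c => ⟨FormulaPair.finite_add (fun c => (p.pair_mem.1 c).1) c, fun ψ hψ => by
      rcases FormulaPair.mem_add hψ with rfl | hψ
      exacts [hφ, (p.pair_mem.1 c).2 hψ]⟩, h⟩
  refine ⟨q, ?_, ?_⟩
  · show p.pair ≤ q.pair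
    rw [hq]
    exact FormulaPair.subset_add _ _ _
  · rw [hq, FormulaPair.add_same]
    exact Set.mem_insert _ _

/-- Adding `¬φ` changes nothing, and a condition is not separable. -/
theorem not_forces_of_neg_mem {p : Condition T} (h : φ.neg ∈ p.pair b) :
    ¬ p.pair.Forces T b φ := by
  rw [FormulaPair.Forces, FormulaPair.add_eq_self h]
  exact p.pair_mem.2

theorem forces_of_mem {p : Condition T} (h : φ ∈ p.pair b) : p.pair.Forces T b φ := by
  have hφ := p.isFinite.add b (φ := φ.neg) ((p.isFinite b).2 φ h)
  refine FormulaPair.isSeparable_add_iff.2 (.of_inconsistent (.of_mem (φ := φ) ?_ ?_ ?_)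
    (p.isFinite.isContext _))
  · exact (p.isFinite.isContext b).insert (φ := φ.neg) ((p.isFinite b).2 φ h)
  · exact Or.inr (Or.inr h)
  · exact Set.mem_insert _ _

theorem forces_mono {p q : Condition T} (hqp : q ≤ p) (hφ : φ.IsFormula)
    (h : p.pair.Forces T b φ) : q.pair.Forces T b φ :=
  h.mono hqp q.isFinite hφ

/-- If an extension `q` forced `φ` while `p` forces `¬φ`, both `¬φ` and `¬¬φ` would make `q`
separable, and so would the cut rule alone. If `p` does not force `¬φ`, adding `¬¬φ` yields an
extension that forces `φ`. -/
theorem forces_neg_iff (p : Condition T) (hφ : φ ∈ fragment T) :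
    p.pair.Forces T b φ.neg ↔ ∀ q ≤ p, ¬ q.pair.Forces T b φ := by
  have hf := isFormula_of_mem_fragment (IsTheory.isContext T).isFormula hφ
  constructor
  · intro h q hq h'
    refine q.pair_mem.2 (FormulaPair.IsSeparable.cut q.isFinite (b := b) (φ := φ.neg) h' ?_)
    exact forces_mono hq hf h
  · intro h
    by_contra hp
    obtain ⟨q, hq, hm⟩ := p.exists_of_not_isSeparable
      (neg_mem_fragment (neg_mem_fragment hφ)) hp
    refine h q hq ?_
    refine FormulaPair.Forces.of_inconsistent q.isFinite ?_ (forces_of_mem hm)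
    exact .of_mem (((IsTheory.isContext T).insert (φ := φ.neg) hf).insert (φ := φ.neg.neg) hf)
      (φ := φ.neg) (by simp) (by simp)

/-- The Boolean value of a formula of the fragment. -/
noncomputable def value (T : Set (PreFormula (L.adjoin k) 0)) [IsTheory T] (b : Bool)
    (φ : PreFormula (L.adjoin k) 0) : Heyting.Regular (LowerSet (Condition T)) :=
  Heyting.Regular.toRegular
    -- The conjunct `φ.IsFormula` makes this a down-set for arbitrary `φ`, since forcing is shown to
    -- be monotone for formulae only.
    ⟨{p | φ.IsFormula ∧ p.pair.Forces T b φ}, fun _ _ hqp h => ⟨h.1, forces_mono hqp h.1 h.2⟩⟩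

/-- On the fragment the regularization adds nothing: a condition not forcing `φ` has an extension
containing `¬φ`, below which `φ` is never forced. -/
theorem mem_value (p : Condition T) (hφ : φ ∈ fragment T) :
    p ∈ (value T b φ).val ↔ p.pair.Forces T b φ := by
  have hf := isFormula_of_mem_fragment (IsTheory.isContext T).isFormula hφ
  rw [value, Heyting.Regular.coe_toRegular]
  simp only [mem_compl_lowerSet]
  constructor
  · intro h
    by_contra hp
    obtain ⟨q, hq, hm⟩ := p.exists_of_not_isSeparable (neg_mem_fragment hφ) hp
    refine h q hq fun r hr hr' => ?_
    exact not_forces_of_neg_mem (hr b hm) hr'.2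
  · exact fun h q hq hq' => hq' q le_rfl ⟨hf, forces_mono hq hf h⟩

theorem value_neg (hφ : φ ∈ fragment T) : value T b φ.neg = (value T b φ)ᶜ := by
  refine Heyting.Regular.coe_injective (SetLike.ext fun p => ?_)
  rw [mem_value p (neg_mem_fragment hφ), Heyting.Regular.coe_compl, mem_compl_lowerSet,
    forces_neg_iff p hφ]
  exact forall₂_congr fun q _ => not_congr (mem_value q hφ).symm

theorem value_eq_iInf {ι : Sort*} {f : ι → PreFormula (L.adjoin k) 0} (hφ : φ ∈ fragment T)
    (hf : ∀ i, f i ∈ fragment T)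
    (h : ∀ p : Condition T, p.pair.Forces T b φ ↔ ∀ i, p.pair.Forces T b (f i)) :
    value T b φ = ⨅ i, value T b (f i) := by
  refine Heyting.Regular.coe_injective (SetLike.ext fun p => ?_)
  rw [mem_value p hφ, coe_iInf_regular, LowerSet.mem_iInf_iff, h p]
  exact forall_congr' fun i => (mem_value p (hf i)).symm

theorem value_eq_top (hφ : φ ∈ fragment T) (h : ∀ p : Condition T, p.pair.Forces T b φ) :
    value T b φ = ⊤ := by
  refine Heyting.Regular.coe_injective (SetLike.ext fun p => ?_)
  rw [mem_value p hφ]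
  exact iff_of_true (h p) trivial

end Condition

open Condition

/-! ### The models -/

theorem Term.lift_subst_fvar (t : Term L 0) (β : Fin n → Term L 0) :
    (t.lift n).subst β .fvar = t := by
  cases t with
  | bvar i => exact i.elim0
  | fvar x => rfl
  | const c => rfl

/-- The rule `eqSymm` covers variables only; for terms, `eqSubst` is applied to the formula `t = x`.
-/
theorem derivable_symm (s t : Term L 0) : Derivable {.eq t t, .eq s t} {.eq t s} := by
  have h := Derivable.eqSubst (k := 1) (.eq (t.lift 1) (.bvar 0))
    ((Term.finite_freeVars _).union (Term.finite_freeVars _)) (fun _ => s) (fun _ => t)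
  simp only [PreFormula.inst, PreFormula.subst, Set.range_const] at h
  rwa [Term.lift_subst_fvar, Term.lift_subst_fvar] at h

theorem derivable_trans (s t r : Term L 0) : Derivable {.eq t r, .eq s t} {.eq s r} := by
  have h := Derivable.eqSubst (k := 1) (.eq (.bvar 0) (r.lift 1))
    ((Term.finite_freeVars _).union (Term.finite_freeVars _)) (fun _ => s) (fun _ => t)
  simp only [PreFormula.inst, PreFormula.subst, Set.range_const] at h
  rwa [Term.lift_subst_fvar, Term.lift_subst_fvar] at h

theorem derivable_rel_congr (R : L.Rel) (s t : Fin (L.arity R) → Term L 0) :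
    Derivable (insert (.rel R t) (Set.range fun i => .eq (s i) (t i))) {.rel R s} :=
  Derivable.eqSubst (.rel R fun i => .bvar i) (Set.finite_iUnion fun _ => Term.finite_freeVars _)
    s t

/-- Turns derivable sequents with finitely many premises into inequalities of values, and so the
equality rules into the axioms of a Boolean valued model. -/
theorem le_value_of_derivable [IsTheory T] {b : Bool} {Φ : Set (PreFormula (L.adjoin k) 0)}
    {ψ : PreFormula (L.adjoin k) 0} (hΦ : Φ.Finite) (hΦT : Φ ⊆ fragment T) (hψ : ψ ∈ fragment T)
    (h : Derivable Φ {ψ}) {a : Heyting.Regular (LowerSet (Condition T))}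
    (ha : ∀ φ ∈ Φ, a ≤ value T b φ) : a ≤ value T b ψ := by
  have hf := fun φ => isFormula_of_mem_fragment (IsTheory.isContext T).isFormula (φ := φ)
  intro p hp
  exact (mem_value p hψ).2 (FormulaPair.forces_of_derivable p.isFinite hΦ
    (fun φ hφ => hf φ (hΦT hφ)) (hf ψ hψ) h fun φ hφ => (mem_value p (hΦT hφ)).1 (ha φ hφ hp))

theorem value_eq_refl [IsTheory T] (b : Bool) (t : TermDomain (L.adjoin k)) :
    value T b (.eq t.toTerm t.toTerm) = ⊤ :=
  top_le_iff.1 (le_value_of_derivable Set.finite_empty (Set.empty_subset _)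
    (eq_mem_fragment T t t) (.eqRefl _) (by simp))

theorem value_eq_symm_le [IsTheory T] (b : Bool) (s t : TermDomain (L.adjoin k)) :
    value T b (.eq s.toTerm t.toTerm) ≤ value T b (.eq t.toTerm s.toTerm) := by
  refine le_value_of_derivable (Set.toFinite _) ?_ (eq_mem_fragment T t s) (derivable_symm _ _) ?_
  · rintro _ (rfl | rfl)
    exacts [eq_mem_fragment T t t, eq_mem_fragment T s t]
  · rintro _ (rfl | rfl)
    exacts [le_top.trans_eq (value_eq_refl b t).symm, le_rfl]

theorem value_eq_symm [IsTheory T] (b : Bool) (s t : TermDomain (L.adjoin k)) :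
    value T b (.eq s.toTerm t.toTerm) = value T b (.eq t.toTerm s.toTerm) :=
  le_antisymm (value_eq_symm_le b s t) (value_eq_symm_le b t s)

variable (T) in
/-- The model with index `b`. -/
noncomputable def termModel [IsTheory T] (b : Bool) :
    BVModel (L.adjoin k) (Heyting.Regular (LowerSet (Condition T)))
      (TermDomain (L.adjoin k)) where
  nonempty := ⟨.inl ⟨0⟩⟩
  eqv s t := value T b (.eq s.toTerm t.toTerm)
  rel R t := value T b (.rel R fun i => (t i).toTerm)
  const c := .inr c
  eqv_refl t := value_eq_refl b t
  eqv_symm s t := value_eq_symm b s t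
  eqv_trans s t r := by
    refine le_value_of_derivable (Set.toFinite _) ?_ (eq_mem_fragment T s r)
      (derivable_trans _ t.toTerm _) ?_
    · rintro _ (rfl | rfl)
      exacts [eq_mem_fragment T t r, eq_mem_fragment T s t]
    · rintro _ (rfl | rfl)
      exacts [inf_le_right, inf_le_left]
  rel_congr R s t := by
    refine le_value_of_derivable ((Set.finite_range _).insert _) ?_ (rel_mem_fragment T R t)
      (derivable_rel_congr R _ fun i => (s i).toTerm) ?_
    · rintro _ (rfl | ⟨i, rfl⟩)
      exacts [rel_mem_fragment T R s, eq_mem_fragment T (t i) (s i)]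
    · rintro _ (rfl | ⟨i, rfl⟩)
      · exact inf_le_right
      -- `eqSubst` takes its equations in the reverse direction, so symmetry intervenes.
      · exact inf_le_left.trans ((iInf_le _ i).trans (value_eq_symm b (s i) (t i)).le)

theorem toTerm_eval [IsTheory T] {b : Bool} (a : Var.{u} → TermDomain (L.adjoin k))
    (e : Fin n → TermDomain (L.adjoin k)) (t : Term (L.adjoin k) n) :
    ((t.eval (termModel T b) a e).toTerm : Term (L.adjoin k) 0) =
      t.subst (fun i => (e i).toTerm) fun x => (a x).toTerm := by
  cases t <;> rfl

/-- The truth lemma: each connective matches its forcing clause. Slots and variables carry elements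
of the domain, so the induction can pass under quantifiers. -/
theorem eval_termModel [IsTheory T] {b : Bool} (a : Var.{u} → TermDomain (L.adjoin k))
    (φ : PreFormula (L.adjoin k) n) (e : Fin n → TermDomain (L.adjoin k))
    (hφ : φ.subst (fun i => (e i).toTerm) (fun x => (a x).toTerm) ∈ fragment T) :
    φ.eval (termModel T b) a e =
      value T b (φ.subst (fun i => (e i).toTerm) fun x => (a x).toTerm) := by
  have hctx := (IsTheory.isContext T).isFormula
  induction φ with
  | eq t s =>
    simp only [PreFormula.eval, PreFormula.subst, ← toTerm_eval (T := T) (b := b)]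
    rfl
  | rel R t =>
    simp only [PreFormula.eval, PreFormula.subst, ← toTerm_eval (T := T) (b := b)]
    rfl
  | neg φ ih =>
    have hm := components_subset_fragment hφ rfl
    simp only [PreFormula.eval, PreFormula.subst]
    rw [ih e hm, value_neg hm]
  | conj f ih =>
    have hm := fun i => components_subset_fragment hφ ⟨i, rfl⟩
    simp only [PreFormula.eval, PreFormula.subst]
    refine Eq.trans (iInf_congr fun i => ih i e (hm i)) (value_eq_iInf hφ hm fun p =>
      FormulaPair.forces_conj_iff p.isFinite (isFormula_of_mem_fragment hctx hφ)).symm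
  | @all n j φ ih =>
    have hm := fun t => components_subset_fragment hφ ⟨t, rfl⟩
    simp only [PreFormula.eval, PreFormula.subst] at hm ⊢
    refine Eq.trans ?_ (value_eq_iInf hφ hm fun p =>
      FormulaPair.forces_all_iff p.isFinite (isFormula_of_mem_fragment hctx hφ)).symm
    refine iInf_congr fun t => ?_
    -- Terms of the domain contain no slots, hence the two successive substitutions merge into one
    -- along the appended tuple.
    have key : PreFormula.inst (k := j) (PreFormula.subst φ
        (Fin.addCases (fun i => .bvar (Fin.castAdd 0 i)) fun i => (e i).toTerm.lift (n := 0) j)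
        fun x => (a x).toTerm.lift (n := 0) j) (fun i => (t i).toTerm) =
        φ.subst (fun i => (Fin.append t e i).toTerm) fun x => (a x).toTerm := by
      unfold PreFormula.inst
      rw [PreFormula.subst_subst]
      congr 1
      · funext i
        refine Fin.addCases (fun i => ?_) (fun i => ?_) i
        · simp [Term.subst]
        · simp [TermDomain.toTerm_lift, TermDomain.toTerm_subst]
      · funext x
        simp only [TermDomain.toTerm_lift, TermDomain.toTerm_subst]
    exact (ih _ (Set.mem_of_eq_of_mem key.symm (hm t))).trans (congrArg (value T b) key).symm

/-- Every condition forces each member `φ` of `T`, as `T` together with `¬φ` is inconsistent. -/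
theorem termModel_models [IsTheory T] (b : Bool) : (termModel T b).Models T := by
  intro φ hφ a
  have hs : φ.subst (fun i => (Fin.elim0 i : TermDomain (L.adjoin k)).toTerm)
      (fun x => (a x).toTerm) = φ := by
    refine Eq.trans ?_ (φ.subst_eq_self (ρ := fun x => (a x).toTerm)
      fun x hx => (IsTheory.notMem_freeVars hφ x hx).elim)
    congr 1
    funext i
    exact i.elim0
  have hm := subset_fragment T hφ
  rw [eval_termModel a φ _ (hs.symm ▸ hm), hs]
  have hc := IsTheory.isContext T
  exact value_eq_top hm fun p => FormulaPair.forces_of_inconsistent p.isFinite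
    (.of_mem (φ := φ) (hc.insert (φ := φ.neg) (hc.isFormula φ hφ)) (Or.inr hφ) (Or.inl rfl))

theorem value_expand [IsTheory T] (α : PreFormula L 0) (hα : α.expand k ∈ fragment T) :
    value T true (α.expand k) = value T false (α.expand k) := by
  refine Heyting.Regular.coe_injective (SetLike.ext fun p => ?_)
  rw [mem_value p hα, mem_value p hα]
  exact FormulaPair.forces_expand_iff α

theorem toTerm_expand (t : TermDomain L) :
    (t.toTerm : Term L n).expand k = TermDomain.toTerm (L := L.adjoin k) t := by
  cases t <;> rfl

theorem termModel_reduct [IsTheory T] : (termModel T true).reduct = (termModel T false).reduct := by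
  have heqv : ∀ b, (termModel T b).reduct.eqv =
      fun s t => value T b (.eq s.toTerm t.toTerm) := fun b => rfl
  have hrel : ∀ b, (termModel T b).reduct.rel =
      fun R t => value T b (.rel (L := L.adjoin k) (some R) fun i => (t i).toTerm) := fun b => rfl
  have hconst : ∀ b, (termModel T b).reduct.const = .inr := fun b => rfl
  refine BVModel.ext ?_ ?_ ((hconst true).trans (hconst false).symm)
  · rw [heqv, heqv]
    funext s t
    have h : (PreFormula.eq (n := 0) (TermDomain.toTerm (L := L) s)
        (TermDomain.toTerm (L := L) t)).expand k =
        .eq (TermDomain.toTerm (L := L.adjoin k) s) (TermDomain.toTerm (L := L.adjoin k) t) :=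
      congrArg₂ PreFormula.eq (toTerm_expand (L := L) s) (toTerm_expand (L := L) t)
    have := value_expand (T := T) _ (h ▸ eq_mem_fragment T s t)
    rwa [h] at this
  · rw [hrel, hrel]
    funext R t
    have h : (PreFormula.rel (n := 0) R fun i => TermDomain.toTerm (L := L) (t i)).expand k =
        .rel (L := L.adjoin k) (some R) fun i => TermDomain.toTerm (L := L.adjoin k) (t i) :=
      congrArg (PreFormula.rel (L := L.adjoin k) (some R)) (funext fun i => toTerm_expand (L := L) (t i))
    have := value_expand (T := T) _ (h ▸ rel_mem_fragment T (some R) t)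
    rwa [h] at this

/-! ### Implicit definability implies explicit definability -/

theorem ImplicitlyBooleanDefinable.explicitly [IsTheory T] (h : ImplicitlyBooleanDefinable T) :
    ExplicitlyBooleanDefinable T := by
  let w : Fin k → TermDomain (L.adjoin k) := fun i => .inl ⟨i⟩
  have hw : Function.Injective fun i : Fin k => ((i : ℕ) : Ordinal.{u}) :=
    Nat.cast_injective.comp Fin.val_injective
  refine .of_separable (fun φ hφ => IsTheory.isSentence φ hφ) hw ?_
  let R : PreFormula (L.adjoin k) 0 := .rel (L := L.adjoin k) none fun i => (w i).toTerm
  have hR : R ∈ fragment T := rel_mem_fragment T none w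
  have key : value T true R = value T false R := h _ _ (termModel T true) (termModel T false)
    (termModel_models true) (termModel_models false) termModel_reduct w
  by_contra hs
  -- Being inseparable, this pair is a condition. It forces `R(w)` on the side `true` but not on the
  -- side `false`, which contradicts the equality of values.
  let p : FormulaPair (L.adjoin k) := fun b => if b then {R} else {R.neg}
  obtain ⟨q, hq⟩ := exists_pair_eq (T := T) (p := p) ⟨fun b => by
    cases b
    · exact ⟨Set.finite_singleton _, Set.singleton_subset_iff.2 (neg_mem_fragment hR)⟩
    · exact ⟨Set.finite_singleton _, Set.singleton_subset_iff.2 hR⟩, by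
    rintro hs'
    refine hs ?_
    rw [FormulaPair.IsSeparable, Set.union_comm T, Set.union_comm T] at hs'
    exact hs'⟩
  have h₁ : q ∈ (value T true R).val :=
    (mem_value q hR).2 (forces_of_mem (by rw [hq]; exact Set.mem_singleton _))
  rw [key, mem_value q hR] at h₁
  exact not_forces_of_neg_mem (by rw [hq]; exact Set.mem_singleton _) h₁

end InfLogic

/-- Boolean Beth definability for `L_{∞ω}`: for a set-sized `L_{∞ω}`-theory `T` (a set of
sentences) in the signature `L ∪ {R}` with `R` a new `k`-ary relation symbol. -/
theorem mainTheorem6 (L : InfLogic.Signature.{u}) (k : ℕ)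
    (T : Set (InfLogic.PreFormula (L.adjoin k) 0)) (hsmall : Small.{u} T)
    (hT : ∀ φ ∈ T, φ.IsSentence) :
    InfLogic.ImplicitlyBooleanDefinable T ↔ InfLogic.ExplicitlyBooleanDefinable T := by
  have : InfLogic.IsTheory T := ⟨hsmall, hT⟩
  exact ⟨fun h => h.explicitly, fun h => h.implicitly⟩
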